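/- Let $X$ be a Banach space over $\mathbb K\in\{\mathbb R,\mathbb C\}$, $\xi$ an ordinal and $K\subset X^*$ weak$^*$-compact. Set $1/\infty=0$. **Szlenk index.** For $\varepsilon>0$ and $L\subset X^*$ let $s_\varepsilon(L)$ be the set of those $x^*\in L$ such that $\operatorname{diam}(V\cap L)>\varepsilon$ (norm diameter) for every weak$^*$-neighbourhood $V$ of $x^*$. Let $s^0_\varepsilon(L)=L$, $s^{\zeta+1}_\varepsilon(L)=s_\varepsilon(s^\zeta_\varepsilon(L))$, $s^\zeta_\varepsilon(L)=\bigcap_{\eta<\zeta}s^\eta_\varepsilon(L)$ for limit $\zeta$; for $\varepsilon\leqslant 0$ let $s^\zeta_\varepsilon(L)=L$. For $\varepsilon>0$ let $Sz(K,\varepsilon)$ be the least $\zeta$ with $s^\zeta_\varepsilon(K)=\varnothing$ ($\infty$ if there is none), and $Sz(K)=\sup_{\varepsilon>0}Sz(K,\varepsilon)$. If $Sz(K)\leqslant\omega^{\xi+1}$, let $Sz_\xi(K,\varepsilon)$ be the least integer $n\geqslant1$ with $Sz(K,\varepsilon)\leqslant\omega^\xi n$, and let $$\mathbf p_\xi(K)=\limsup_{\varepsilon\to0^+}\frac{\log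 Sz_\xi(K,\varepsilon)}{|\log\varepsilon|}\in[0,\infty];$$ if $Sz(K)>\omega^{\xi+1}$, let $\mathbf p_\xi(K)=\infty$. For $1\leqslant q<\infty$, $K$ has *$\xi$-$q$-summable Szlenk index* if there is $M\geqslant0$ such that $\sum_{i=1}^n\varepsilon_i^q\leqslant M^q$ whenever $\varepsilon_1,\dots,\varepsilon_n\geqslant0$ and $s^{\omega^\xi}_{\varepsilon_1}\cdots s^{\omega^\xi}_{\varepsilon_n}(K)\neq\varnothing$. **Trees.** Finite sequences are ordered by the initial segment relation, $MAX(T)$ is the set of maximal members of a set $T$ of sequences, and $\zeta+(\zeta_i)_i=(\zeta+\zeta_i)_i$. Let $\Gamma_{0,1}=\{(0)\}$. Given $\Gamma_{\xi,1}$, for $1\leqslant i\leqslant n$ let $$\Lambda_{\xi,n,i}=\{(\omega^\xi(n-1)+t_1)\smallfrown\cdots\smallfrown(\omega^\xi(n-i)+t_i): t_1,\dots,t_{i-1}\in MAX(\Gamma_{\xi,1}),\ t_i\in\Gamma_{\xi,1}\},$$ $\Gamma_{\xi,n}=\bigcup_{i=1}^n\Lambda_{\xi,n,i}$, and $\Gamma_{\xi+1,1}=\bigcup_{n\geqslant1}\Gamma_{\xi,n}$;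 for limit $\xi$ let $\Gamma_{\xi,1}=\bigcup_{\zeta<\xi}(\omega^\zeta+\Gamma_{\zeta+1,1})$. Define $\mathbb P_{\xi,n}:\Gamma_{\xi,n}\to[0,1]$ by $\mathbb P_{0,1}((0))=1$; $\mathbb P_{\xi,n}(s)=\mathbb P_{\xi,1}(t_i)$ for $s\in\Lambda_{\xi,n,i}$ written as above; $\mathbb P_{\xi+1,1}(t)=\frac1n\mathbb P_{\xi,n}(t)$ for $t\in\Gamma_{\xi,n}$; and $\mathbb P_{\xi,1}(\omega^\zeta+t)=\mathbb P_{\zeta+1,1}(t)$ for limit $\xi$, $\zeta<\xi$, $t\in\Gamma_{\zeta+1,1}$. For a directed set $D$ and a set $T$ of sequences of ordinals, $T.D$ is the set of sequences $(\zeta_j,u_j)_{j=1}^k$ with $(\zeta_j)_{j=1}^k\in T$ and $u_j\in D$; put $\mathbb P_{\xi,n}((\zeta_j,u_j)_j)=\mathbb P_{\xi,n}((\zeta_j)_j)$. A collection $(x_t)_{t\in\Gamma_{\xi,n}.D}\subset X$ is *weakly null* if, for each $t\in\{\varnothing\}\cup\Gamma_{\xi,n}.D$ and each ordinal $\zeta$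 such that the sequences $t\smallfrown(\zeta,u)$, $u\in D$, belong to $\Gamma_{\xi,n}.D$, the net $(x_{t\smallfrown(\zeta,u)})_{u\in D}$ converges weakly to $0$. For $t\in MAX(\Gamma_{\xi,n}.D)$ let $z^t_i=\sum_{\Lambda_{\xi,n,i}.D\ni s\leqslant t}\mathbb P_{\xi,n}(s)x_s$. **The quantity $\alpha_{\xi,p}$.** Let $r_K(x)=\max_{x^*\in K}\operatorname{Re}x^*(x)$ ($=0$ if $K=\varnothing$). For $1\leqslant p\leqslant\infty$ let $\alpha_{\xi,p,n}(K)$ be the infimum of those $\alpha>0$ such that, for every directed set $D$, every $(a_i)_{i=1}^n\in\mathbb K^n$ and every weakly null $(x_t)_{t\in\Gamma_{\xi,n}.D}\subset B_X$, $$\inf_{t\in MAX(\Gamma_{\xi,n}.D)}r_K\Bigl(\sum_{i=1}^na_iz^t_i\Bigr)\leqslant\alpha\,\|(a_i)_{i=1}^n\|_{\ell_p^n},$$ and let $\alpha_{\xi,p}(K)=\sup_{n\geqslant1}\alpha_{\xi,p,n}(K)$. **Theorem.** (i) If $q=\max\{\mathbf p_\xi(K),1\}\in[1,\infty]$ and $1/p+1/q=1$,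 then $$p=\sup\{r\in[1,\infty]:\alpha_{\xi,r}(K)<\infty\}.$$ (ii) If $1\leqslant q<\infty$ and $1/p+1/q=1$, then $K$ has $\xi$-$q$-summable Szlenk index if and only if $\alpha_{\xi,p}(K)<\infty$. -/

import Mathlib

open scoped ENNReal Topology

universe u v w

noncomputable section

namespace Szlenk

open Filter Set

/-! ### The trees `Γ_{ξ,n}`, their levels and the coefficients `ℙ_{ξ,n}`

Trees are sets of non-empty finite sequences, ordered by the initial segment relation `<+:`. -/

/-- `MAX(T)`: the maximal members of `T` for the initial segment order. -/
def maxNodes {α : Type*} (T : Set (List α)) : Set (List α) :=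
  {t ∈ T | ∀ s ∈ T, t <+: s → s = t}

/-- `ζ + (ζ_i)_i = (ζ + ζ_i)_i`. -/
def shift (ζ : Ordinal.{w}) (t : List Ordinal.{w}) : List Ordinal.{w} :=
  t.map (ζ + ·)

/-- `assemble β n [t_1, …, t_i] = (β(n-1) + t_1) ⌢ … ⌢ (β(n-i) + t_i)`, for `i ≤ n`. -/
def assemble (β : Ordinal.{w}) : ℕ → List (List Ordinal.{w}) → List Ordinal.{w}
  | _, [] => []
  | 0, _ :: _ => []
  | n + 1, t :: L => shift (β * n) t ++ assemble β n L

/-- `s = (β(n-1) + t_1) ⌢ … ⌢ (β(n-i) + t_i)` where `L = [t_1, …, t_{i-1}]` lists maximal members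
of `G`, `t = t_i` is a member of `G` and `i = L.length + 1 ≤ n`. -/
def IsDecomposition (β : Ordinal.{w}) (G : Set (List Ordinal.{w})) (n : ℕ)
    (L : List (List Ordinal.{w})) (t s : List Ordinal.{w}) : Prop :=
  L.length + 1 ≤ n ∧ (∀ r ∈ L, r ∈ maxNodes G) ∧ t ∈ G ∧ s = assemble β n (L ++ [t])

/-- The `i`-th level (`1 ≤ i ≤ n`) of the `n`-levelled tree obtained from `G`, with `β = ω ^ ξ`. -/
def levelOf (β : Ordinal.{w}) (G : Set (List Ordinal.{w})) (n i : ℕ) : Set (List Ordinal.{w}) :=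
  {s | ∃ L t, IsDecomposition β G n L t s ∧ i = L.length + 1}

/-- The `n`-levelled tree obtained from `G`: the union of its levels. -/
def stackOf (β : Ordinal.{w}) (G : Set (List Ordinal.{w})) (n : ℕ) : Set (List Ordinal.{w}) :=
  ⋃ i ∈ Set.Icc 1 n, levelOf β G n i

/-- `Γ_{ξ,1}`. -/
def Gamma₁ (ξ : Ordinal.{w}) : Set (List Ordinal.{w}) :=
  Ordinal.limitRecOn ξ {[0]}
    (fun ξ G => ⋃ n ∈ Set.Ici (1 : ℕ), stackOf (Ordinal.omega0 ^ ξ) G n)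
    (fun ξ hξ G => ⋃ (ζ : Ordinal.{w}) (h : ζ < ξ),
      shift (Ordinal.omega0 ^ ζ) '' G (ζ + 1) (hξ.add_one_lt h))

/-- The level `Λ_{ξ,n,i}`. -/
def Lambda (ξ : Ordinal.{w}) (n i : ℕ) : Set (List Ordinal.{w}) :=
  levelOf (Ordinal.omega0 ^ ξ) (Gamma₁ ξ) n i

/-- The tree `Γ_{ξ,n}`. -/
def Gamma (ξ : Ordinal.{w}) (n : ℕ) : Set (List Ordinal.{w}) :=
  ⋃ i ∈ Set.Icc 1 n, Lambda ξ n i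

open Classical in
/-- Coefficients on the `n`-levelled tree obtained from coefficients `P` on `G`: the value at
`(β(n-1) + t_1) ⌢ … ⌢ (β(n-i) + t_i)` is `P t_i`. -/
def stackProb (β : Ordinal.{w}) (G : Set (List Ordinal.{w})) (P : List Ordinal.{w} → ℝ) (n : ℕ)
    (s : List Ordinal.{w}) : ℝ :=
  if h : ∃ t L, IsDecomposition β G n L t s then P h.choose else 0

open Classical in
/-- `ℙ_{ξ,1}`: it is `1` on `Γ_{0,1}`; `ℙ_{ξ+1,1}(t) = ℙ_{ξ,n}(t) / n` for `t ∈ Γ_{ξ,n}`; and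
`ℙ_{ξ,1}(ω ^ ζ + t) = ℙ_{ζ+1,1}(t)` for `ζ < ξ`, `ξ` a limit, `t ∈ Γ_{ζ+1,1}`. -/
def prob₁ (ξ : Ordinal.{w}) : List Ordinal.{w} → ℝ :=
  Ordinal.limitRecOn ξ (fun _ => 1)
    (fun ξ P t =>
      if h : ∃ n : ℕ, 1 ≤ n ∧ t ∈ Gamma ξ n then
        stackProb (Ordinal.omega0 ^ ξ) (Gamma₁ ξ) P h.choose t / h.choose
      else 0)
    (fun ξ hξ P s =>
      if h : ∃ ζ, ζ < ξ ∧ ∃ t ∈ Gamma₁ (ζ + 1), s = shift (Ordinal.omega0 ^ ζ) t then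
        P (h.choose + 1) (hξ.add_one_lt h.choose_spec.1) h.choose_spec.2.choose
      else 0)

/-- `ℙ_{ξ,n}`. -/
def prob (ξ : Ordinal.{w}) (n : ℕ) : List Ordinal.{w} → ℝ :=
  stackProb (Ordinal.omega0 ^ ξ) (Gamma₁ ξ) (prob₁ ξ) n

/-! The coefficients are well defined, i.e. satisfy their defining recursion. -/

theorem Gamma₁_zero : Gamma₁ (0 : Ordinal.{w}) = {[0]} := by
  simp [Gamma₁]

theorem Gamma₁_succ (ξ : Ordinal.{w}) :
    Gamma₁ (ξ + 1) = ⋃ n ∈ Set.Ici (1 : ℕ), Gamma ξ n := by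
  simp only [Gamma₁, Ordinal.limitRecOn_add_one]
  rfl

theorem Gamma₁_limit (ξ : Ordinal.{w}) (hξ : Order.IsSuccLimit ξ) :
    Gamma₁ ξ = ⋃ (ζ : Ordinal.{w}) (_ : ζ < ξ),
      shift (Ordinal.omega0 ^ ζ) '' Gamma₁ (ζ + 1) := by
  rw [Gamma₁, Ordinal.limitRecOn_limit _ _ _ _ hξ]
  rfl

theorem mem_Gamma_iff (ξ : Ordinal.{w}) (n : ℕ) (s : List Ordinal.{w}) :
    s ∈ Gamma ξ n ↔
      ∃ L t, IsDecomposition (Ordinal.omega0 ^ ξ) (Gamma₁ ξ) n L t s := by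
  simp only [Gamma, Lambda, levelOf, Set.mem_iUnion, Set.mem_Icc, Set.mem_ofPred_eq]
  constructor
  · rintro ⟨i, -, L, t, h, -⟩
    exact ⟨L, t, h⟩
  · rintro ⟨L, t, h⟩
    exact ⟨L.length + 1, ⟨by omega, h.1⟩, L, t, h, rfl⟩

theorem assemble_lt {β : Ordinal.{w}} (n : ℕ) (L : List (List Ordinal.{w}))
    (hL : ∀ r ∈ L, ∀ a ∈ r, a < β) : ∀ a ∈ assemble β n L, a < β * n := by
  induction n generalizing L with
  | zero => cases L <;> simp [assemble]
  | succ n ih =>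
    cases L with
    | nil => simp [assemble]
    | cons t L =>
      intro a ha
      simp only [assemble, List.mem_append, shift, List.mem_map] at ha
      have e : β * ((n + 1 : ℕ) : Ordinal.{w}) = β * n + β := by
        rw [Nat.cast_add, Nat.cast_one, mul_add, mul_one]
      rw [e]
      rcases ha with ⟨b, hb, rfl⟩ | ha
      · exact add_lt_add_right (hL t (by simp) b hb) _
      · exact (ih L (fun r hr => hL r (by simp [hr])) a ha).trans_le le_self_add

theorem assemble_inj {β : Ordinal.{w}} (n : ℕ) (L L' : List (List Ordinal.{w}))
    (hl : L.length ≤ n) (hl' : L'.length ≤ n)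
    (hL : ∀ r ∈ L, r ≠ [] ∧ ∀ a ∈ r, a < β) (hL' : ∀ r ∈ L', r ≠ [] ∧ ∀ a ∈ r, a < β)
    (h : assemble β n L = assemble β n L') : L = L' := by
  induction n generalizing L L' with
  | zero =>
    rw [List.length_eq_zero_iff.1 (Nat.le_zero.1 hl), List.length_eq_zero_iff.1 (Nat.le_zero.1 hl')]
  | succ n ih =>
    cases L with
    | nil =>
      cases L' with
      | nil => rfl
      | cons t' L' =>
        have := (hL' t' (by simp)).1
        simp [assemble, shift, this] at h
    | cons t L =>
      cases L' with
      | nil =>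
        have := (hL t (by simp)).1
        simp [assemble, shift, this] at h
      | cons t' L' =>
        simp only [assemble] at h
        have A := assemble_lt (β := β) n L (fun r hr => (hL r (by simp [hr])).2)
        have A' := assemble_lt (β := β) n L' (fun r hr => (hL' r (by simp [hr])).2)
        have B : ∀ x : List Ordinal.{w}, ∀ a ∈ shift (β * n) x, β * n ≤ a := by
          intro x a ha
          simp only [shift, List.mem_map] at ha
          obtain ⟨b, -, rfl⟩ := ha
          exact le_self_add
        have key : ∀ x y : List Ordinal.{w}, (∀ a ∈ y, a < β * n) →
            (shift (β * n) x ++ y).filter (fun a => decide (β * n ≤ a)) = shift (β * n) x := by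
          intro x y hy
          rw [List.filter_append, List.filter_eq_self.2, List.filter_eq_nil_iff.2, List.append_nil]
          · intro a ha
            simpa using hy a ha
          · intro a ha
            simpa using B x a ha
        have e : shift (β * n) t = shift (β * n) t' := by
          rw [← key t _ A, h, key t' _ A']
        have e2 : assemble β n L = assemble β n L' := by
          rw [e] at h
          exact List.append_cancel_left h
        have e3 : t = t' := by
          refine List.map_injective_iff.2 ?_ e
          intro a b hab
          simpa using hab
        rw [e3, ih L L' (by simpa using hl) (by simpa using hl')
          (fun r hr => hL r (by simp [hr])) (fun r hr => hL' r (by simp [hr])) e2]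

/-- Members of `Γ_{ξ,1}` are non-empty sequences in `[0, ω ^ ξ)`. -/
theorem Gamma₁_bound (ξ : Ordinal.{w}) :
    ∀ t ∈ Gamma₁ ξ, t ≠ [] ∧ ∀ a ∈ t, a < Ordinal.omega0 ^ ξ := by
  induction ξ using Ordinal.limitRecOn with
  | zero => simp [Gamma₁_zero]
  | add_one ξ ih =>
    intro s hs
    simp only [Gamma₁_succ, Set.mem_iUnion, mem_Gamma_iff] at hs
    obtain ⟨n, hn, L, t, h1, h2, h3, rfl⟩ := hs
    have hb : ∀ r ∈ L ++ [t], r ≠ [] ∧ ∀ a ∈ r, a < Ordinal.omega0 ^ ξ := by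
      intro r hr
      simp only [List.mem_append, List.mem_singleton] at hr
      rcases hr with hr | rfl
      · exact ih r (h2 r hr).1
      · exact ih r h3
    constructor
    · intro h0
      have := assemble_inj n (L ++ [t]) [] (by simpa using h1) (by simp) hb (by simp)
        (by rw [h0]; cases n <;> rfl)
      simp at this
    · intro a ha
      refine (assemble_lt n _ (fun r hr => (hb r hr).2) a ha).trans ?_
      rw [Ordinal.opow_add, Ordinal.opow_one]
      exact mul_lt_mul_of_pos_left (Ordinal.natCast_lt_omega0 n)
        (Ordinal.opow_pos _ Ordinal.omega0_pos)
  | limit ξ hξ ih =>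
    intro s hs
    simp only [Gamma₁_limit ξ hξ, Set.mem_iUnion, Set.mem_image] at hs
    obtain ⟨ζ, hζ, t, ht, rfl⟩ := hs
    obtain ⟨h1, h2⟩ := ih (ζ + 1) (hξ.add_one_lt hζ) t ht
    refine ⟨by simpa [shift] using h1, ?_⟩
    intro a ha
    simp only [shift, List.mem_map] at ha
    obtain ⟨b, hb, rfl⟩ := ha
    refine Ordinal.isPrincipal_add_omega0_opow ξ ?_ ((h2 b hb).trans ?_)
    · exact (Ordinal.opow_lt_opow_iff_right Ordinal.one_lt_omega0).2 hζ
    · exact (Ordinal.opow_lt_opow_iff_right Ordinal.one_lt_omega0).2 (hξ.add_one_lt hζ)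

theorem IsDecomposition.bound {ξ : Ordinal.{w}} {n : ℕ} {L : List (List Ordinal.{w})}
    {t s : List Ordinal.{w}}
    (h : IsDecomposition (Ordinal.omega0 ^ ξ) (Gamma₁ ξ) n L t s) :
    ∀ r ∈ L ++ [t], r ≠ [] ∧ ∀ a ∈ r, a < Ordinal.omega0 ^ ξ := by
  intro r hr
  simp only [List.mem_append, List.mem_singleton] at hr
  rcases hr with hr | rfl
  · exact Gamma₁_bound ξ r (h.2.1 r hr).1
  · exact Gamma₁_bound ξ r h.2.2.1

theorem IsDecomposition.unique {ξ : Ordinal.{w}} {n : ℕ} {L L' : List (List Ordinal.{w})}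
    {t t' s : List Ordinal.{w}}
    (h : IsDecomposition (Ordinal.omega0 ^ ξ) (Gamma₁ ξ) n L t s)
    (h' : IsDecomposition (Ordinal.omega0 ^ ξ) (Gamma₁ ξ) n L' t' s) : L = L' ∧ t = t' := by
  have := assemble_inj n (L ++ [t]) (L' ++ [t']) (by simpa using h.1) (by simpa using h'.1)
    h.bound h'.bound (h.2.2.2.symm.trans h'.2.2.2)
  simpa using List.append_inj' this rfl

theorem Gamma_head {ξ : Ordinal.{w}} {n : ℕ} {s : List Ordinal.{w}} (hs : s ∈ Gamma ξ n) :
    ∃ a r, s = a :: r ∧ ∃ m : ℕ, n = m + 1 ∧ Ordinal.omega0 ^ ξ * m ≤ a ∧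
      a < Ordinal.omega0 ^ ξ * (m + 1 : ℕ) := by
  obtain ⟨L, t, h⟩ := (mem_Gamma_iff ξ n s).1 hs
  have hb := h.bound
  obtain ⟨h1, -, -, rfl⟩ := h
  obtain ⟨m, rfl⟩ : ∃ m, n = m + 1 := ⟨n - 1, by omega⟩
  have hlt := assemble_lt (m + 1) (L ++ [t]) (fun r hr => (hb r hr).2)
  obtain ⟨u, L', hu⟩ : ∃ u L', L ++ [t] = u :: L' := by
    cases L with
    | nil => exact ⟨t, [], rfl⟩
    | cons u L => exact ⟨u, L ++ [t], rfl⟩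
  rw [hu] at hlt hb ⊢
  have hu0 := (hb u (by simp)).1
  obtain ⟨b, u', rfl⟩ : ∃ b u', u = b :: u' := List.exists_cons_of_ne_nil hu0
  refine ⟨Ordinal.omega0 ^ ξ * m + b, shift (Ordinal.omega0 ^ ξ * m) u' ++
    assemble (Ordinal.omega0 ^ ξ) m L', by simp [assemble, shift], m, rfl, le_self_add, ?_⟩
  exact hlt _ (by simp [assemble, shift])

theorem Gamma_index_unique {ξ : Ordinal.{w}} {n n' : ℕ} {s : List Ordinal.{w}}
    (hs : s ∈ Gamma ξ n) (hs' : s ∈ Gamma ξ n') : n = n' := by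
  obtain ⟨a, r, rfl, m, rfl, h1, h2⟩ := Gamma_head hs
  obtain ⟨a', r', e, m', rfl, h1', h2'⟩ := Gamma_head hs'
  obtain ⟨rfl, rfl⟩ := List.cons.inj e
  have key : ∀ i j : ℕ, Ordinal.omega0 ^ ξ * i ≤ a → a < Ordinal.omega0 ^ ξ * (j + 1 : ℕ) →
      i ≤ j := by
    intro i j hi hj
    by_contra! hlt
    have : ((j + 1 : ℕ) : Ordinal.{w}) ≤ i := by exact_mod_cast hlt
    exact absurd (hj.trans_le ((mul_le_mul_right this _).trans hi)) (lt_irrefl _)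
  have := key m m' h1 h2'
  have := key m' m h1' h2
  omega

theorem shift_injective (ζ : Ordinal.{w}) : Function.Injective (shift ζ) :=
  List.map_injective_iff.2 fun a b hab => by simpa using hab

theorem shift_index_unique {ζ ζ' : Ordinal.{w}} {t t' : List Ordinal.{w}}
    (ht : t ∈ Gamma₁ (ζ + 1)) (ht' : t' ∈ Gamma₁ (ζ' + 1))
    (h : shift (Ordinal.omega0 ^ ζ) t = shift (Ordinal.omega0 ^ ζ') t') : ζ = ζ' ∧ t = t' := by
  have key : ∀ {ζ ζ' : Ordinal.{w}} {t t' : List Ordinal.{w}}, t ∈ Gamma₁ (ζ + 1) →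
      t' ∈ Gamma₁ (ζ' + 1) → shift (Ordinal.omega0 ^ ζ) t = shift (Ordinal.omega0 ^ ζ') t' →
      ζ ≤ ζ' := by
    intro ζ ζ' t t' ht ht' h
    obtain ⟨h0, -⟩ := Gamma₁_bound _ t ht
    obtain ⟨h0', hb'⟩ := Gamma₁_bound _ t' ht'
    obtain ⟨b, u, rfl⟩ := List.exists_cons_of_ne_nil h0
    obtain ⟨b', u', rfl⟩ := List.exists_cons_of_ne_nil h0'
    simp only [shift, List.map_cons, List.cons.injEq] at h
    have h1 : Ordinal.omega0 ^ ζ ≤ Ordinal.omega0 ^ ζ' + b' := h.1 ▸ le_self_add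
    have h2 : Ordinal.omega0 ^ ζ' + b' < Ordinal.omega0 ^ (ζ' + 1) := by
      refine Ordinal.isPrincipal_add_omega0_opow _ ?_ (hb' b' (by simp))
      exact (Ordinal.opow_lt_opow_iff_right Ordinal.one_lt_omega0).2
        (Order.lt_add_one_iff.2 le_rfl)
    exact Order.lt_add_one_iff.1
      ((Ordinal.opow_lt_opow_iff_right Ordinal.one_lt_omega0).1 (h1.trans_lt h2))
  obtain rfl : ζ = ζ' := le_antisymm (key ht ht' h) (key ht' ht h.symm)
  exact ⟨rfl, shift_injective _ h⟩

theorem prob₁_zero (t : List Ordinal.{w}) : prob₁ 0 t = 1 := by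
  simp [prob₁]

theorem prob_eq {ξ : Ordinal.{w}} {n : ℕ} {L : List (List Ordinal.{w})} {t s : List Ordinal.{w}}
    (h : IsDecomposition (Ordinal.omega0 ^ ξ) (Gamma₁ ξ) n L t s) : prob ξ n s = prob₁ ξ t := by
  have hex : ∃ t L, IsDecomposition (Ordinal.omega0 ^ ξ) (Gamma₁ ξ) n L t s := ⟨t, L, h⟩
  rw [prob, stackProb, dif_pos hex, (hex.choose_spec.choose_spec.unique h).2]

theorem prob₁_succ {ξ : Ordinal.{w}} {n : ℕ} {t : List Ordinal.{w}} (ht : t ∈ Gamma ξ n) :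
    prob₁ (ξ + 1) t = prob ξ n t / n := by
  have hn : 1 ≤ n := by
    obtain ⟨-, -, -, m, rfl, -⟩ := Gamma_head ht
    omega
  have hex : ∃ n : ℕ, 1 ≤ n ∧ t ∈ Gamma ξ n := ⟨n, hn, ht⟩
  rw [prob₁, Ordinal.limitRecOn_add_one, dif_pos hex,
    Gamma_index_unique hex.choose_spec.2 ht]
  rfl

theorem prob₁_limit {ξ ζ : Ordinal.{w}} (hξ : Order.IsSuccLimit ξ) (hζ : ζ < ξ)
    {t : List Ordinal.{w}} (ht : t ∈ Gamma₁ (ζ + 1)) :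
    prob₁ ξ (shift (Ordinal.omega0 ^ ζ) t) = prob₁ (ζ + 1) t := by
  have hex : ∃ ζ', ζ' < ξ ∧ ∃ t' ∈ Gamma₁ (ζ' + 1),
      shift (Ordinal.omega0 ^ ζ) t = shift (Ordinal.omega0 ^ ζ') t' := ⟨ζ, hζ, t, ht, rfl⟩
  rw [prob₁, Ordinal.limitRecOn_limit _ _ _ _ hξ, dif_pos hex]
  obtain ⟨e1, e2⟩ := shift_index_unique ht hex.choose_spec.2.choose_spec.1
    hex.choose_spec.2.choose_spec.2
  change prob₁ (hex.choose + 1) hex.choose_spec.2.choose = _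
  rw [← e2, ← e1]

/-! ### Trees over a directed set and weakly null collections -/

/-- For a tree `T` of sequences of ordinals, `T.D` consists of the sequences `(ζ_j, u_j)_j` with
`(ζ_j)_j ∈ T` and `u_j ∈ D`. -/
def dTree (T : Set (List Ordinal.{w})) (D : Type v) : Set (List (Ordinal.{w} × D)) :=
  {t | t.map Prod.fst ∈ T}

section Banach

variable {𝕜 : Type v} [RCLike 𝕜] {X : Type u} [NormedAddCommGroup X] [NormedSpace 𝕜 X]

variable (𝕜) in
/-- A collection `(x_t)` indexed by a tree over a directed set `D` (values of `x` outside the tree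
are irrelevant) is weakly null if, for every node or root `t` and every ordinal `ζ` such that the
sequences `t ⌢ (ζ, u)` belong to the tree, the net `(x_{t ⌢ (ζ, u)})_{u ∈ D}` converges weakly
to `0`. -/
def IsWeaklyNull {D : Type u} [Preorder D] (T : Set (List Ordinal.{w}))
    (x : List (Ordinal.{w} × D) → X) : Prop :=
  ∀ (t : List (Ordinal.{w} × D)) (ζ : Ordinal.{w}),
    t.map Prod.fst ++ [ζ] ∈ T →
      Tendsto (fun u : D => toWeakSpace 𝕜 X (x (t ++ [(ζ, u)]))) atTop (𝓝 0)

open Classical in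
variable (𝕜) in
/-- `z_i^t = ∑ ℙ_{ξ,n}(s) x_s`, the sum over all `s ≤ t` in the level `Λ_{ξ,n,i}.D`. -/
def levelSum {D : Type u} (ξ : Ordinal.{w}) (n i : ℕ) (x : List (Ordinal.{w} × D) → X)
    (t : List (Ordinal.{w} × D)) : X :=
  ∑ s ∈ t.inits.toFinset with s ∈ dTree (Lambda ξ n i) D,
    ((prob ξ n (s.map Prod.fst) : ℝ) : 𝕜) • x s

/-! ### The quantities `α_{ξ,p,n}(K)` and `α_{ξ,p}(K)` -/

/-- `r_K(x) = max_{f ∈ K} Re f(x)`, and `0` if `K` is empty. -/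
def supportFun (K : Set (WeakDual 𝕜 X)) (x : X) : ℝ :=
  sSup ((fun f : WeakDual 𝕜 X => RCLike.re (f x)) '' K)

/-- `α_{ξ,p,n}(K)`. -/
def alphaN (ξ : Ordinal.{w}) (p : ℝ≥0∞) (n : ℕ) (K : Set (WeakDual 𝕜 X)) : ℝ≥0∞ :=
  sInf {A : ℝ≥0∞ | ∃ α : ℝ, 0 < α ∧ A = ENNReal.ofReal α ∧
    ∀ (D : Type u) [Preorder D] [IsDirectedOrder D] [Nonempty D] (a : Fin n → 𝕜)
      (x : List (Ordinal.{w} × D) → X),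
      (∀ t ∈ dTree (Gamma ξ n) D, ‖x t‖ ≤ 1) →
      IsWeaklyNull 𝕜 (Gamma ξ n) x →
      ⨅ t : maxNodes (dTree (Gamma ξ n) D),
          supportFun K (∑ i : Fin n, a i • levelSum 𝕜 ξ n (i + 1) x t) ≤
        α * ‖(WithLp.toLp p a : PiLp p fun _ : Fin n => 𝕜)‖}

/-- `α_{ξ,p}(K) = sup_{n ≥ 1} α_{ξ,p,n}(K)`. -/
def alpha (ξ : Ordinal.{w}) (p : ℝ≥0∞) (K : Set (WeakDual 𝕜 X)) : ℝ≥0∞ :=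
  ⨆ n ∈ Set.Ici (1 : ℕ), alphaN ξ p n K

/-! ### The Szlenk derivation, Szlenk index, power type and summability -/

/-- `s_ε(K)` for `ε > 0`: those `f ∈ K` all of whose weak* neighbourhoods `V` satisfy
`diam (V ∩ K) > ε`, the diameter being taken in the dual norm. -/
def derivative (ε : ℝ) (K : Set (WeakDual 𝕜 X)) : Set (WeakDual 𝕜 X) :=
  {f ∈ K | ∀ V ∈ 𝓝 f,
    ENNReal.ofReal ε < Metric.ediam (WeakDual.toStrongDual '' (V ∩ K))}

/-- The transfinite derivations `s_ε^o(K)`, with the convention `s_ε^o(K) = K` for `ε ≤ 0`. -/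
def iterDerivative (ε : ℝ) (o : Ordinal.{w}) (K : Set (WeakDual 𝕜 X)) : Set (WeakDual 𝕜 X) :=
  if 0 < ε then
    Ordinal.limitRecOn o K (fun _ S => derivative ε S) (fun o _ S => ⋂ (ζ) (h : ζ < o), S ζ h)
  else K

open Classical in
/-- `Sz(K, ε)`, with value `⊤` (that is, `∞`) if no derivation of `K` is empty. -/
def szlenkIndexAt (K : Set (WeakDual 𝕜 X)) (ε : ℝ) : WithTop Ordinal.{w} :=
  if ∃ o : Ordinal.{w}, iterDerivative ε o K = ∅ then
    ((sInf {o : Ordinal.{w} | iterDerivative ε o K = ∅} : Ordinal.{w}) : WithTop Ordinal.{w})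
  else ⊤

/-- `Sz(K)`. -/
def szlenkIndex (K : Set (WeakDual 𝕜 X)) : WithTop Ordinal.{w} :=
  ⨆ ε : Set.Ioi (0 : ℝ), szlenkIndexAt K ε

/-- `Sz_ξ(K, ε)`: the least `n ≥ 1` with `Sz(K, ε) ≤ ω ^ ξ * n`. -/
def szlenkCount (ξ : Ordinal.{w}) (K : Set (WeakDual 𝕜 X)) (ε : ℝ) : ℕ :=
  sInf {n : ℕ | 1 ≤ n ∧
    szlenkIndexAt K ε ≤ ((Ordinal.omega0 ^ ξ * n : Ordinal.{w}) : WithTop Ordinal.{w})}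

open Classical in
/-- The `ξ`-Szlenk power type of `K`, with values in `[0, ∞]`. -/
def powerType (ξ : Ordinal.{w}) (K : Set (WeakDual 𝕜 X)) : ℝ≥0∞ :=
  if szlenkIndex K ≤ ((Ordinal.omega0 ^ (ξ + 1) : Ordinal.{w}) : WithTop Ordinal.{w}) then
    limsup (fun ε : ℝ => ENNReal.ofReal (Real.log (szlenkCount ξ K ε) / |Real.log ε|)) (𝓝[>] 0)
  else ⊤

/-- `K` has `M`-`ξ`-`q`-summable Szlenk index: for all `ε_1, …, ε_n ≥ 0` such that
`s^{ω^ξ}_{ε_1} … s^{ω^ξ}_{ε_n}(K)` is non-empty, `∑ ε_i ^ q ≤ M ^ q`. -/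
def HasSummableIndexWith (M : ℝ) (ξ : Ordinal.{w}) (q : ℝ) (K : Set (WeakDual 𝕜 X)) : Prop :=
  ∀ l : List ℝ, (∀ ε ∈ l, 0 ≤ ε) →
    (l.foldr (fun ε S => iterDerivative ε (Ordinal.omega0 ^ ξ) S) K).Nonempty →
    (l.map (· ^ q)).sum ≤ M ^ q

/-- `K` has `ξ`-`q`-summable Szlenk index. -/
def HasSummableIndex (ξ : Ordinal.{w}) (q : ℝ) (K : Set (WeakDual 𝕜 X)) : Prop :=
  ∃ M : ℝ, 0 ≤ M ∧ HasSummableIndexWith M ξ q K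

end Banach

end Szlenk

end

/-!
Both parts rest on comparing non-empty derivations `s^{ω^ξ}_{ε_1} ⋯ s^{ω^ξ}_{ε_n}(K)` with weakly
null trees on `Γ_{ξ,n}`, in both directions.

*From derivations to trees* (`exists_weaklyNull_of_foldDerivative_nonempty`). If the derivation is
non-empty, there is a weakly null tree in the unit ball along each branch of which some functional
of `K` is at least about `ε_i / 5` on the `i`-th level. The members of `Γ_{ξ,n}` are strictly
decreasing sequences of ordinals below `ω^ξ n`, and a node with last entry `ζ` is given a functional
in the `ζ`-th stage of the derivation; passing to an extension of the node leaves room for one more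
derivation `s_ε`, and near a point of `s_ε(S)` there are functionals of `S` that are larger than
`ε / 5` at weakly small vectors of the unit ball (`exists_large_of_mem_derivative`).

*From trees to derivations* (`LevelProperty`, `levelProperty`,
`LevelProperty.foldDerivative_nonempty`). Suppose that each maximal node of a weakly null tree
carries a functional of `K` whose value at `∑ a_i z_i` is at least `ρ`. Then
`s^{ω^ξ}_{ε_1} ⋯ s^{ω^ξ}_{ε_n}(K) ≠ ∅` for some `ε_i` with `ρ ≤ ∑ |a_i| ε_i` up to a small error.
The statement is proved for finitely many compact sets at once: each maximal node has a colour `c`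
and its functional lies in a compact set `S c`. This makes it possible to peel off the levels one by
one, since the (discretised) numbers `ε_2, …, ε_n` obtained for the tree above a node of the first
level serve as the colour of that node. For `ξ = 0` the functionals converge weak* along an
ultrafilter and the vectors are weakly null, so the limit functional lies in the derivation. For
`ξ + 1` a branch through `Γ_{ξ,n}` gives `n` bounded numbers with mean at least about `ρ`, so a fixed
proportion of them is at least `ρ - δ`; letting `n` grow and using compactness yields a point of
`s^{ω^{ξ+1}}_{ρ-δ}(S c)`. The limit case follows from compactness and
the finiteness of the set of colours.

Hölder's inequality and its converse turn the two comparisons into part (ii). Part (i) follows from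
(ii): `r`-summability bounds the power type by `r` (`powerType_le_of_hasSummableIndex`), and a power
type below `s < r` bounds the number of `ε_i ≥ η` by a multiple of `η^{-s}`, so that `∑ ε_i^r` is
bounded (`hasSummableIndex_of_powerType_lt`).
-/

namespace Szlenk

open Filter Set

/-! ### Transfinite derivations -/

section Derivation

variable {𝕜 : Type v} [RCLike 𝕜] {X : Type u} [NormedAddCommGroup X] [NormedSpace 𝕜 X]
  {S T : Set (WeakDual 𝕜 X)} {ε δ : ℝ} {o a b : Ordinal.{w}}

theorem derivative_subset (ε : ℝ) (S : Set (WeakDual 𝕜 X)) : derivative ε S ⊆ S := fun _ h => h.1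

theorem derivative_mono (h : S ⊆ T) (hε : δ ≤ ε) : derivative ε S ⊆ derivative δ T := by
  intro f hf
  refine ⟨h hf.1, fun V hV => ?_⟩
  exact (ENNReal.ofReal_le_ofReal hε).trans_lt ((hf.2 V hV).trans_le
    (Metric.ediam_mono (image_mono (inter_subset_inter_right _ h))))

theorem isClosed_derivative (hS : IsClosed S) (ε : ℝ) : IsClosed (derivative ε S) := by
  rw [← isOpen_compl_iff, isOpen_iff_mem_nhds]
  intro f hf
  by_cases hfS : f ∈ S
  · have : ∃ V ∈ 𝓝 f, ¬ ENNReal.ofReal ε <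
        Metric.ediam (WeakDual.toStrongDual '' (V ∩ S)) := by
      by_contra! h
      exact hf ⟨hfS, h⟩
    obtain ⟨V, hV, hd⟩ := this
    obtain ⟨W, hWV, hW, hfW⟩ := mem_nhds_iff.1 hV
    filter_upwards [hW.mem_nhds hfW] with g hg hgS
    exact hd ((hgS.2 W (hW.mem_nhds hg)).trans_le
      (Metric.ediam_mono (image_mono (inter_subset_inter_left _ hWV))))
  · filter_upwards [hS.isOpen_compl.mem_nhds hfS] with g hg hgS
    exact hg hgS.1

theorem iterDerivative_of_nonpos (hε : ε ≤ 0) (o : Ordinal.{w}) (S : Set (WeakDual 𝕜 X)) :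
    iterDerivative ε o S = S := if_neg hε.not_gt

@[simp] theorem iterDerivative_zero (ε : ℝ) (S : Set (WeakDual 𝕜 X)) :
    iterDerivative ε (0 : Ordinal.{w}) S = S := by
  simp [iterDerivative]

theorem iterDerivative_add_one (hε : 0 < ε) (o : Ordinal.{w}) (S : Set (WeakDual 𝕜 X)) :
    iterDerivative ε (o + 1) S = derivative ε (iterDerivative ε o S) := by
  simp [iterDerivative, hε]

theorem iterDerivative_limit (ho : Order.IsSuccLimit o) (ε : ℝ) (S : Set (WeakDual 𝕜 X)) :
    iterDerivative ε o S = ⋂ (ζ) (_ : ζ < o), iterDerivative ε ζ S := by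
  by_cases hε : 0 < ε
  · simp only [iterDerivative, hε, if_true]
    rw [Ordinal.limitRecOn_limit _ _ _ _ ho]
  · have h0 : (0 : Ordinal.{w}) < o := ho.bot_lt
    simp only [iterDerivative, hε, if_false]
    ext f
    simp only [mem_iInter]
    exact ⟨fun h _ _ => h, fun h => h 0 h0⟩

theorem iterDerivative_anti (ε : ℝ) (S : Set (WeakDual 𝕜 X)) (h : a ≤ b) :
    iterDerivative ε b S ⊆ iterDerivative ε a S := by
  rcases le_or_gt ε 0 with hε | hε
  · simp [iterDerivative_of_nonpos hε]
  induction b using Ordinal.limitRecOn with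
  | zero => rw [nonpos_iff_eq_zero.1 h]
  | add_one b ih =>
    rcases h.eq_or_lt with rfl | h
    · rfl
    · rw [iterDerivative_add_one hε]
      exact (derivative_subset _ _).trans (ih (Order.lt_add_one_iff.1 h))
  | limit b hb _ =>
    rcases h.eq_or_lt with rfl | h
    · rfl
    · rw [iterDerivative_limit hb]
      exact iInter₂_subset a h

theorem iterDerivative_subset (ε : ℝ) (o : Ordinal.{w}) (S : Set (WeakDual 𝕜 X)) :
    iterDerivative ε o S ⊆ S := by
  simpa using iterDerivative_anti ε S (zero_le : 0 ≤ o)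

theorem iterDerivative_mono (h : S ⊆ T) (hε : δ ≤ ε) (o : Ordinal.{w}) :
    iterDerivative ε o S ⊆ iterDerivative δ o T := by
  rcases le_or_gt δ 0 with hδ | hδ
  · rw [iterDerivative_of_nonpos hδ]
    exact (iterDerivative_subset _ _ _).trans h
  have hε' := hδ.trans_le hε
  induction o using Ordinal.limitRecOn with
  | zero => simpa
  | add_one o ih =>
    rw [iterDerivative_add_one hε', iterDerivative_add_one hδ]
    exact derivative_mono ih hε
  | limit o ho ih =>
    rw [iterDerivative_limit ho, iterDerivative_limit ho]
    exact iInter₂_mono ih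

theorem iterDerivative_add (ε : ℝ) (a b : Ordinal.{w}) (S : Set (WeakDual 𝕜 X)) :
    iterDerivative ε (a + b) S = iterDerivative ε b (iterDerivative ε a S) := by
  rcases le_or_gt ε 0 with hε | hε
  · simp [iterDerivative_of_nonpos hε]
  induction b using Ordinal.limitRecOn with
  | zero => simp
  | add_one b ih => rw [← add_assoc, iterDerivative_add_one hε, iterDerivative_add_one hε, ih]
  | limit b hb ih =>
    rw [iterDerivative_limit hb, iterDerivative_limit (Ordinal.isSuccLimit_add a hb)]
    apply subset_antisymm
    · refine subset_iInter₂ fun ζ hζ => ?_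
      rw [← ih ζ hζ]
      exact iInter₂_subset (a + ζ) (add_lt_add_right hζ a)
    · refine subset_iInter₂ fun ζ hζ => ?_
      rcases le_or_gt a ζ with h | h
      · obtain ⟨c, rfl⟩ := le_iff_exists_add.1 h
        have hc : c < b := lt_of_add_lt_add_left hζ
        rw [ih c hc]
        exact iInter₂_subset c hc
      · refine (iInter₂_subset 0 hb.bot_lt).trans ?_
        rw [iterDerivative_zero]
        exact iterDerivative_anti _ _ h.le

theorem isCompact_iterDerivative (hS : IsCompact S) (ε : ℝ) (o : Ordinal.{w}) :
    IsCompact (iterDerivative ε o S) := by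
  rcases le_or_gt ε 0 with hε | hε
  · rwa [iterDerivative_of_nonpos hε]
  induction o using Ordinal.limitRecOn with
  | zero => simpa
  | add_one o ih =>
    rw [iterDerivative_add_one hε]
    exact ih.of_isClosed_subset (isClosed_derivative ih.isClosed _) (derivative_subset _ _)
  | limit o ho ih =>
    refine hS.of_isClosed_subset ?_ (iterDerivative_subset _ _ _)
    rw [iterDerivative_limit ho]
    exact isClosed_biInter fun ζ hζ => (ih ζ hζ).isClosed

/-- By weak* compactness, a derivation of limit order is non-empty as soon as all the earlier ones
are. -/
theorem iterDerivative_limit_nonempty (hS : IsCompact S) (ho : Order.IsSuccLimit o)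
    (h : ∀ ζ < o, (iterDerivative ε ζ S).Nonempty) : (iterDerivative ε o S).Nonempty := by
  rw [iterDerivative_limit ho, ← iInter_subtype (· < o) (fun ζ => iterDerivative ε ζ.1 S)]
  have : Nonempty (Iio o) := ⟨⟨0, ho.bot_lt⟩⟩
  refine IsCompact.nonempty_iInter_of_directed_nonempty_isCompact_isClosed
    (fun ζ : Iio o => iterDerivative ε ζ.1 S) ?_ (fun ζ => h ζ ζ.2)
    (fun ζ => isCompact_iterDerivative hS _ _) (fun ζ => (isCompact_iterDerivative hS _ _).isClosed)
  exact directed_of_isDirected_le fun a b hab => iterDerivative_anti _ _ hab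

/-- `s^o_{ε_1} ⋯ s^o_{ε_n}(S)` for a list `[ε_1, …, ε_n]`. -/
abbrev foldDerivative (o : Ordinal.{w}) (l : List ℝ) (S : Set (WeakDual 𝕜 X)) :
    Set (WeakDual 𝕜 X) :=
  l.foldr (fun ε S => iterDerivative ε o S) S

theorem foldDerivative_subset (o : Ordinal.{w}) (l : List ℝ) (S : Set (WeakDual 𝕜 X)) :
    foldDerivative o l S ⊆ S := by
  induction l with
  | nil => rfl
  | cons ε l ih => exact (iterDerivative_subset _ _ _).trans ih

theorem foldDerivative_mono (o : Ordinal.{w}) (l : List ℝ) (h : S ⊆ T) :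
    foldDerivative o l S ⊆ foldDerivative o l T := by
  induction l with
  | nil => exact h
  | cons ε l ih => exact iterDerivative_mono ih le_rfl o

theorem isCompact_foldDerivative (hS : IsCompact S) (o : Ordinal.{w}) (l : List ℝ) :
    IsCompact (foldDerivative o l S) := by
  induction l with
  | nil => exact hS
  | cons ε l ih => exact isCompact_iterDerivative ih _ _

/-- Deleting the derivations with `ε_i < η` and decreasing the other `ε_i` to `η` gives a larger
set. -/
theorem foldDerivative_subset_count (o : Ordinal.{w}) (l : List ℝ) (S : Set (WeakDual 𝕜 X))
    (η : ℝ) :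
    foldDerivative o l S ⊆
      iterDerivative η (o * (l.countP (fun ε => decide (η ≤ ε)) : ℕ)) S := by
  induction l with
  | nil => simp
  | cons ε l ih =>
    by_cases h : η ≤ ε
    · rw [List.countP_cons_of_pos (by simpa using h), Nat.cast_add, Nat.cast_one, mul_add, mul_one,
        iterDerivative_add]
      exact iterDerivative_mono ih h o
    · rw [List.countP_cons_of_neg (by simpa using h)]
      exact (iterDerivative_subset _ _ _).trans ih

end Derivation

/-! ### Maximal branches of the trees -/

section Branches

variable {ξ ζ : Ordinal.{w}} {n i : ℕ} {s t r : List Ordinal.{w}}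

theorem maxNodes_of_subset {α : Type*} {T T' : Set (List α)} (h : T ⊆ T') {t : List α}
    (ht : t ∈ T) (ht' : t ∈ maxNodes T') : t ∈ maxNodes T :=
  ⟨ht, fun s hs => ht'.2 s (h hs)⟩

theorem shift_prefix_shift : shift ζ s <+: shift ζ t ↔ s <+: t :=
  List.prefix_map_iff_of_injective fun a b hab => by simpa using hab

theorem isDecomposition_cons {β : Ordinal.{w}} {G : Set (List Ordinal.{w})}
    {L : List (List Ordinal.{w})} :
    IsDecomposition β G (n + 1) (r :: L) t s ↔
      r ∈ maxNodes G ∧ ∃ s', IsDecomposition β G n L t s' ∧ s = shift (β * n) r ++ s' := by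
  constructor
  · rintro ⟨h1, h2, h3, rfl⟩
    exact ⟨h2 r (by simp), _, ⟨by simpa using h1, fun r hr => h2 r (by simp [hr]), h3, rfl⟩, rfl⟩
  · rintro ⟨hr, s', ⟨h1, h2, h3, rfl⟩, rfl⟩
    exact ⟨by simpa using h1, by simpa using ⟨hr, h2⟩, h3, rfl⟩

theorem isDecomposition_nil {β : Ordinal.{w}} {G : Set (List Ordinal.{w})} :
    IsDecomposition β G (n + 1) [] t s ↔ t ∈ G ∧ s = shift (β * n) t := by
  have : assemble β n [] = [] := by cases n <;> rfl
  simp [IsDecomposition, assemble, this]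

theorem mem_Lambda_one :
    s ∈ Lambda ξ (n + 1) 1 ↔ ∃ t ∈ Gamma₁ ξ, s = shift (Ordinal.omega0 ^ ξ * n) t := by
  constructor
  · rintro ⟨L, t, h, hL⟩
    obtain rfl : L = [] := List.length_eq_zero_iff.1 (by omega)
    exact ⟨t, isDecomposition_nil.1 h⟩
  · rintro ⟨t, h⟩
    exact ⟨[], t, isDecomposition_nil.2 h, rfl⟩

theorem mem_Lambda_succ :
    s ∈ Lambda ξ (n + 1) (i + 2) ↔ ∃ r ∈ maxNodes (Gamma₁ ξ), ∃ s' ∈ Lambda ξ n (i + 1),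
      s = shift (Ordinal.omega0 ^ ξ * n) r ++ s' := by
  constructor
  · rintro ⟨L, t, h, hL⟩
    obtain ⟨r, L, rfl⟩ : ∃ r L', L = r :: L' := List.exists_cons_of_length_pos (by omega)
    obtain ⟨hr, s', h', e⟩ := isDecomposition_cons.1 h
    exact ⟨r, hr, s', ⟨L, t, h', by simpa using hL⟩, e⟩
  · rintro ⟨r, hr, s', ⟨L, t, h, hL⟩, e⟩
    exact ⟨r :: L, t, isDecomposition_cons.2 ⟨hr, s', h, e⟩, by simpa using hL⟩

theorem mem_Gamma_succ :
    s ∈ Gamma ξ (n + 1) ↔ (∃ t ∈ Gamma₁ ξ, s = shift (Ordinal.omega0 ^ ξ * n) t) ∨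
      ∃ r ∈ maxNodes (Gamma₁ ξ), ∃ s' ∈ Gamma ξ n, s = shift (Ordinal.omega0 ^ ξ * n) r ++ s' := by
  rw [mem_Gamma_iff]
  constructor
  · rintro ⟨L, t, h⟩
    cases L with
    | nil => exact Or.inl ⟨t, isDecomposition_nil.1 h⟩
    | cons r L =>
      obtain ⟨hr, s', h', e⟩ := isDecomposition_cons.1 h
      exact Or.inr ⟨r, hr, s', (mem_Gamma_iff _ _ _).2 ⟨L, t, h'⟩, e⟩
  · rintro (⟨t, h⟩ | ⟨r, hr, s', hs', e⟩)
    · exact ⟨[], t, isDecomposition_nil.2 h⟩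
    · obtain ⟨L, t, h⟩ := (mem_Gamma_iff _ _ _).1 hs'
      exact ⟨r :: L, t, isDecomposition_cons.2 ⟨hr, s', h, e⟩⟩

theorem Gamma_zero : Gamma ξ 0 = ∅ := by
  ext s
  simp [mem_Gamma_iff, IsDecomposition]

theorem ne_nil_of_mem_Gamma (h : s ∈ Gamma ξ n) : s ≠ [] := by
  obtain ⟨a, r, rfl, -⟩ := Gamma_head h
  simp

theorem Gamma_subset_Gamma₁_succ (hn : 1 ≤ n) : Gamma ξ n ⊆ Gamma₁ (ξ + 1) := by
  rw [Gamma₁_succ]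
  exact subset_biUnion_of_mem (u := fun n => Gamma ξ n) hn

theorem mem_Gamma₁_succ : s ∈ Gamma₁ (ξ + 1) ↔ ∃ n, 1 ≤ n ∧ s ∈ Gamma ξ n := by
  simp [Gamma₁_succ]

theorem mem_Gamma₁_limit (hξ : Order.IsSuccLimit ξ) :
    s ∈ Gamma₁ ξ ↔ ∃ ζ < ξ, ∃ t ∈ Gamma₁ (ζ + 1), s = shift (Ordinal.omega0 ^ ζ) t := by
  simp only [Gamma₁_limit ξ hξ, mem_iUnion, mem_image, exists_prop, eq_comm]

theorem Gamma_index_eq_of_prefix {m : ℕ} (hs : s ∈ Gamma ξ n) (ht : t ∈ Gamma ξ m)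
    (h : s <+: t) : n = m := by
  obtain ⟨a, r, rfl, m, rfl, h1, h2⟩ := Gamma_head hs
  obtain ⟨a', r', rfl, m', rfl, h1', h2'⟩ := Gamma_head ht
  obtain ⟨rfl, -⟩ := List.cons_prefix_cons.1 h
  have key : ∀ i j : ℕ, Ordinal.omega0 ^ ξ * i ≤ a → a < Ordinal.omega0 ^ ξ * (j + 1 : ℕ) →
      i ≤ j := by
    intro i j hi hj
    by_contra! hlt
    have : ((j + 1 : ℕ) : Ordinal.{w}) ≤ i := by exact_mod_cast hlt
    exact absurd (hj.trans_le ((mul_le_mul_right this _).trans hi)) (lt_irrefl _)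
  have := key m m' h1 h2'
  have := key m' m h1' h2
  omega

theorem shift_index_eq_of_prefix {ζ' : Ordinal.{w}} (hs : s ∈ Gamma₁ (ζ + 1))
    (ht : t ∈ Gamma₁ (ζ' + 1))
    (h : shift (Ordinal.omega0 ^ ζ) s <+: shift (Ordinal.omega0 ^ ζ') t) : ζ = ζ' := by
  have key : ∀ {ζ ζ' b b' : Ordinal.{w}}, b' < Ordinal.omega0 ^ (ζ' + 1) →
      Ordinal.omega0 ^ ζ + b = Ordinal.omega0 ^ ζ' + b' → ζ ≤ ζ' := by
    intro ζ ζ' b b' hb' h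
    have h1 : Ordinal.omega0 ^ ζ ≤ Ordinal.omega0 ^ ζ' + b' := h ▸ le_self_add
    have h2 : Ordinal.omega0 ^ ζ' + b' < Ordinal.omega0 ^ (ζ' + 1) :=
      Ordinal.isPrincipal_add_omega0_opow _
        ((Ordinal.opow_lt_opow_iff_right Ordinal.one_lt_omega0).2
          (Order.lt_add_one_iff.2 le_rfl)) hb'
    exact Order.lt_add_one_iff.1
      ((Ordinal.opow_lt_opow_iff_right Ordinal.one_lt_omega0).1 (h1.trans_lt h2))
  obtain ⟨h0, hb⟩ := Gamma₁_bound _ s hs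
  obtain ⟨h0', hb'⟩ := Gamma₁_bound _ t ht
  obtain ⟨b, u, rfl⟩ := List.exists_cons_of_ne_nil h0
  obtain ⟨b', u', rfl⟩ := List.exists_cons_of_ne_nil h0'
  simp only [shift, List.map_cons, List.cons_prefix_cons] at h
  exact le_antisymm (key (hb' b' (by simp)) h.1) (key (hb b (by simp)) h.1.symm)

theorem maxNodes_Gamma_subset (hn : 1 ≤ n) :
    maxNodes (Gamma ξ n) ⊆ maxNodes (Gamma₁ (ξ + 1)) := by
  refine fun t ht => ⟨Gamma_subset_Gamma₁_succ hn ht.1, fun s hs h => ?_⟩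
  obtain ⟨m, -, hm⟩ := mem_Gamma₁_succ.1 hs
  obtain rfl := Gamma_index_eq_of_prefix ht.1 hm h
  exact ht.2 s hm h

theorem exists_mem_maxNodes_Gamma (ht : t ∈ maxNodes (Gamma₁ (ξ + 1))) :
    ∃ n, 1 ≤ n ∧ t ∈ maxNodes (Gamma ξ n) := by
  obtain ⟨n, hn, h⟩ := mem_Gamma₁_succ.1 ht.1
  exact ⟨n, hn, maxNodes_of_subset (Gamma_subset_Gamma₁_succ hn) h ht⟩

theorem mem_maxNodes_Gamma₁_limit (hξ : Order.IsSuccLimit ξ) :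
    s ∈ maxNodes (Gamma₁ ξ) ↔
      ∃ ζ < ξ, ∃ t ∈ maxNodes (Gamma₁ (ζ + 1)), s = shift (Ordinal.omega0 ^ ζ) t := by
  constructor
  · rintro ⟨h1, h2⟩
    obtain ⟨ζ, hζ, t, ht, rfl⟩ := (mem_Gamma₁_limit hξ).1 h1
    refine ⟨ζ, hζ, t, ⟨ht, fun s hs h => ?_⟩, rfl⟩
    exact shift_injective _ (h2 _ ((mem_Gamma₁_limit hξ).2 ⟨ζ, hζ, s, hs, rfl⟩)
      (shift_prefix_shift.2 h))
  · rintro ⟨ζ, hζ, t, ht, rfl⟩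
    refine ⟨(mem_Gamma₁_limit hξ).2 ⟨ζ, hζ, t, ht.1, rfl⟩, fun s hs h => ?_⟩
    obtain ⟨ζ', -, t', ht', rfl⟩ := (mem_Gamma₁_limit hξ).1 hs
    obtain rfl := shift_index_eq_of_prefix ht.1 ht' h
    rw [ht.2 t' ht' (shift_prefix_shift.1 h)]

/-- The sequences `(ω^ξ(n-1) + t_1) ⌢ ⋯ ⌢ (ω^ξ·0 + t_n)` with all `t_i` maximal in `Γ_{ξ,1}`. For
`n ≥ 1` these are the maximal nodes of `Γ_{ξ,n}`; for `n = 0` it is the empty sequence alone, which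
lets inductions start at `0`. -/
def branches (ξ : Ordinal.{w}) : ℕ → Set (List Ordinal.{w})
  | 0 => {[]}
  | n + 1 => {s | ∃ r ∈ maxNodes (Gamma₁ ξ), ∃ t ∈ branches ξ n,
      s = shift (Ordinal.omega0 ^ ξ * n) r ++ t}

theorem nonempty_branches (h : (maxNodes (Gamma₁ ξ)).Nonempty) (n : ℕ) :
    (branches ξ n).Nonempty := by
  induction n with
  | zero => exact singleton_nonempty _
  | succ n ih =>
    obtain ⟨t, ht⟩ := ih
    obtain ⟨r, hr⟩ := h
    exact ⟨_, r, hr, t, ht, rfl⟩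

theorem branches_subset_Gamma : branches ξ (n + 1) ⊆ Gamma ξ (n + 1) := by
  induction n with
  | zero =>
    rintro _ ⟨r, hr, t, rfl, rfl⟩
    exact mem_Gamma_succ.2 (Or.inl ⟨r, hr.1, by simp⟩)
  | succ n ih =>
    rintro _ ⟨r, hr, t, ht, rfl⟩
    exact mem_Gamma_succ.2 (Or.inr ⟨r, hr, t, ih ht, rfl⟩)

theorem eq_of_mem_branches_of_prefix (ht : t ∈ branches ξ n) (hs : s ∈ Gamma ξ n)
    (h : t <+: s) : s = t := by
  induction n generalizing s t with
  | zero => simp [Gamma_zero] at hs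
  | succ n ih =>
    obtain ⟨r, hr, t, ht, rfl⟩ := ht
    rcases mem_Gamma_succ.1 hs with ⟨r', hr', rfl⟩ | ⟨r', hr', s', hs', rfl⟩
    · have := hr.2 r' hr' (shift_prefix_shift.1 ((List.prefix_append _ _).trans h))
      subst this
      have := h.eq_of_length_le (by simp)
      simp only [List.append_right_eq_self] at this
      simp [this]
    · have hp := (List.prefix_append _ _).trans h
      have := List.prefix_or_prefix_of_prefix hp (List.prefix_append _ s')
      have : r = r' := by
        rcases this with h | h
        · exact (hr.2 r' hr'.1 (shift_prefix_shift.1 h)).symm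
        · exact hr'.2 r hr.1 (shift_prefix_shift.1 h)
      subst this
      rw [ih ht hs' ((List.prefix_append_right_inj _).1 h)]

theorem branches_subset_maxNodes (hn : 1 ≤ n) : branches ξ n ⊆ maxNodes (Gamma ξ n) := by
  obtain ⟨n, rfl⟩ := Nat.exists_eq_succ_of_ne_zero (by omega : n ≠ 0)
  exact fun t ht => ⟨branches_subset_Gamma ht, fun s hs h => eq_of_mem_branches_of_prefix ht hs h⟩

theorem nonempty_maxNodes_Gamma₁ (ξ : Ordinal.{w}) : (maxNodes (Gamma₁ ξ)).Nonempty := by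
  induction ξ using Ordinal.limitRecOn with
  | zero => exact ⟨[0], by simp [maxNodes, Gamma₁_zero]⟩
  | add_one ξ ih =>
    obtain ⟨t, ht⟩ := nonempty_branches ih 1
    exact ⟨t, maxNodes_Gamma_subset le_rfl (branches_subset_maxNodes le_rfl ht)⟩
  | limit ξ hξ ih =>
    obtain ⟨t, ht⟩ := ih (0 + 1) (hξ.add_one_lt hξ.bot_lt)
    exact ⟨_, (mem_maxNodes_Gamma₁_limit hξ).2 ⟨0, hξ.bot_lt, t, ht, rfl⟩⟩

theorem maxNodes_Gamma_eq (hn : 1 ≤ n) : maxNodes (Gamma ξ n) = branches ξ n := by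
  refine subset_antisymm (fun t ht => ?_) (branches_subset_maxNodes hn)
  clear hn
  induction n generalizing t with
  | zero => simp [maxNodes, Gamma_zero] at ht
  | succ n ih =>
    obtain ⟨h1, h2⟩ := ht
    rcases mem_Gamma_succ.1 h1 with ⟨r, hr, rfl⟩ | ⟨r, hr, s, hs, rfl⟩
    · -- such a node is maximal only if there is no further level
      have hr' : r ∈ maxNodes (Gamma₁ ξ) := ⟨hr, fun s hs h => shift_injective _
        (h2 _ (mem_Gamma_succ.2 (Or.inl ⟨s, hs, rfl⟩)) (shift_prefix_shift.2 h))⟩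
      cases n with
      | zero => exact ⟨r, hr', [], rfl, by simp⟩
      | succ n =>
        obtain ⟨t, ht⟩ := nonempty_branches (nonempty_maxNodes_Gamma₁ ξ) (n + 1)
        have := h2 _ (mem_Gamma_succ.2 (Or.inr ⟨r, hr', t, branches_subset_Gamma ht, rfl⟩))
          (List.prefix_append _ _)
        rw [List.append_right_eq_self] at this
        exact absurd this (ne_nil_of_mem_Gamma (branches_subset_Gamma ht))
    · refine ⟨r, hr, s, ih s ⟨hs, fun s' hs' h => ?_⟩, rfl⟩
      have := h2 _ (mem_Gamma_succ.2 (Or.inr ⟨r, hr, s', hs', rfl⟩))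
        ((List.prefix_append_right_inj _).2 h)
      exact List.append_cancel_left this

/-! ### The coefficients -/

theorem prob_shift (ht : t ∈ Gamma₁ ξ) :
    prob ξ (n + 1) (shift (Ordinal.omega0 ^ ξ * n) t) = prob₁ ξ t :=
  prob_eq (isDecomposition_nil.2 ⟨ht, rfl⟩)

theorem prob_shift_append (hr : r ∈ maxNodes (Gamma₁ ξ)) (hs : s ∈ Gamma ξ n) :
    prob ξ (n + 1) (shift (Ordinal.omega0 ^ ξ * n) r ++ s) = prob ξ n s := by
  obtain ⟨L, t, h⟩ := (mem_Gamma_iff _ _ _).1 hs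
  rw [prob_eq h, prob_eq (isDecomposition_cons.2 ⟨hr, s, h, rfl⟩)]

theorem prob₁_nonneg (ht : t ∈ Gamma₁ ξ) : 0 ≤ prob₁ ξ t := by
  induction ξ using Ordinal.limitRecOn generalizing t with
  | zero => simp [prob₁_zero]
  | add_one ξ ih =>
    obtain ⟨n, hn, h⟩ := mem_Gamma₁_succ.1 ht
    rw [prob₁_succ h]
    obtain ⟨L, t, h⟩ := (mem_Gamma_iff _ _ _).1 h
    rw [prob_eq h]
    exact div_nonneg (ih h.2.2.1) n.cast_nonneg
  | limit ξ hξ ih =>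
    obtain ⟨ζ, hζ, t', ht', rfl⟩ := (mem_Gamma₁_limit hξ).1 ht
    rw [prob₁_limit hξ hζ ht']
    exact ih _ (hξ.add_one_lt hζ) ht'

theorem Lambda_subset_Gamma (hi : i < n) : Lambda ξ n (i + 1) ⊆ Gamma ξ n :=
  subset_biUnion_of_mem (u := fun i => Lambda ξ n i) ⟨by omega, by omega⟩

theorem prob_nonneg (hs : s ∈ Gamma ξ n) : 0 ≤ prob ξ n s := by
  obtain ⟨L, t, h⟩ := (mem_Gamma_iff _ _ _).1 hs
  rw [prob_eq h]
  exact prob₁_nonneg h.2.2.1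

theorem exists_mem_Lambda (hs : s ∈ Gamma ξ n) : ∃ i : Fin n, s ∈ Lambda ξ n (i + 1) := by
  obtain ⟨L, t, h⟩ := (mem_Gamma_iff _ _ _).1 hs
  exact ⟨⟨L.length, h.1⟩, L, t, h, rfl⟩

theorem Lambda_index_unique {j : ℕ} (hi : s ∈ Lambda ξ n i) (hj : s ∈ Lambda ξ n j) : i = j := by
  obtain ⟨L, t, h, rfl⟩ := hi
  obtain ⟨L', t', h', rfl⟩ := hj
  rw [(h.unique h').1]

end Branches

/-! ### Weighted sums along branches of `T.D` -/

section Trees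

variable {ξ ζ : Ordinal.{w}} {n i : ℕ} {D : Type*}

/-- `ζ + t` for a sequence `t` of pairs: only the ordinals are shifted. -/
def shiftD (ζ : Ordinal.{w}) (t : List (Ordinal.{w} × D)) : List (Ordinal.{w} × D) :=
  t.map (Prod.map (ζ + ·) id)

@[simp] theorem map_fst_shiftD (t : List (Ordinal.{w} × D)) :
    (shiftD ζ t).map Prod.fst = shift ζ (t.map Prod.fst) := by
  simp [shiftD, shift]

theorem mapProd_injective (ζ : Ordinal.{w}) :
    Function.Injective (Prod.map (ζ + ·) id : Ordinal.{w} × D → Ordinal.{w} × D) :=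
  Function.Injective.prodMap (fun a b h => by simpa using h) Function.injective_id

theorem shiftD_injective (ζ : Ordinal.{w}) :
    Function.Injective (shiftD ζ : List (Ordinal.{w} × D) → _) :=
  List.map_injective_iff.2 (mapProd_injective ζ)

theorem shiftD_prefix_shiftD {s t : List (Ordinal.{w} × D)} :
    shiftD ζ s <+: shiftD ζ t ↔ s <+: t :=
  List.prefix_map_iff_of_injective (mapProd_injective ζ)

/-- A sequence of pairs whose ordinals are the shift of some sequence is itself a shift. -/
theorem exists_eq_shiftD {s : List (Ordinal.{w} × D)} {t : List Ordinal.{w}}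
    (h : s.map Prod.fst = shift ζ t) : ∃ s', s = shiftD ζ s' ∧ s'.map Prod.fst = t := by
  induction s generalizing t with
  | nil =>
    have : t = [] := by simpa [shift, eq_comm] using h
    exact ⟨[], rfl, by simp [this]⟩
  | cons a s ih =>
    cases t with
    | nil => simp [shift] at h
    | cons b t =>
      simp only [shift, List.map_cons, List.cons.injEq] at h
      obtain ⟨s', rfl, h'⟩ := ih h.2
      exact ⟨(b, a.2) :: s', by simp [shiftD, ← h.1], by simp [h']⟩

theorem exists_eq_shiftD_append {s : List (Ordinal.{w} × D)} {r t : List Ordinal.{w}}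
    (h : s.map Prod.fst = shift ζ r ++ t) :
    ∃ r' t', s = shiftD ζ r' ++ t' ∧ r'.map Prod.fst = r ∧ t'.map Prod.fst = t := by
  obtain ⟨s₁, s₂, rfl, h₁, h₂⟩ := List.map_eq_append_iff.1 h
  obtain ⟨r', rfl, h'⟩ := exists_eq_shiftD h₁
  exact ⟨r', s₂, rfl, h', h₂⟩

theorem maxNodes_dTree [Nonempty D] (T : Set (List Ordinal.{w})) :
    maxNodes (dTree T D) = dTree (maxNodes T) D := by
  ext t
  constructor
  · rintro ⟨h1, h2⟩
    refine ⟨h1, fun s hs h => ?_⟩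
    obtain ⟨r, rfl⟩ := h
    have := h2 (t ++ r.map (fun a => (a, Classical.arbitrary D)))
      (by simpa [dTree, Function.comp_def] using hs) (List.prefix_append _ _)
    simp only [List.append_right_eq_self, List.map_eq_nil_iff] at this
    simp [this]
  · rintro ⟨h1, h2⟩
    refine ⟨h1, fun s hs h => ?_⟩
    have := congrArg List.length (h2 _ hs (h.map Prod.fst))
    exact (h.eq_of_length (by simpa using this.symm)).symm

theorem nonempty_dTree [Nonempty D] {T : Set (List Ordinal.{w})} (h : T.Nonempty) :
    (dTree T D).Nonempty := by
  obtain ⟨t, ht⟩ := h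
  exact ⟨t.map (fun a => (a, Classical.arbitrary D)), by simpa [dTree, Function.comp_def] using ht⟩

theorem prefix_of_maxNodes {G : Set (List Ordinal.{w})} {s r : List (Ordinal.{w} × D)}
    (hs : s.map Prod.fst ∈ maxNodes G) (hr : r.map Prod.fst ∈ G)
    (h : r <+: s ∨ s <+: r) : r <+: s := by
  rcases h with h | h
  · exact h
  · have := congrArg List.length (hs.2 _ hr (h.map Prod.fst))
    rw [h.eq_of_length (by simpa using this.symm)]

variable {𝕜 : Type v} [RCLike 𝕜] {X : Type*} [NormedAddCommGroup X] [NormedSpace 𝕜 X]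

open Classical in
variable (𝕜) in
/-- `∑ P(s) x_s`, the sum over all `s ≤ t` in `Λ.D`. -/
noncomputable def weightedSum (Λ : Set (List Ordinal.{w})) (P : List Ordinal.{w} → ℝ)
    (x : List (Ordinal.{w} × D) → X) (t : List (Ordinal.{w} × D)) : X :=
  ∑ s ∈ t.inits.toFinset with s ∈ dTree Λ D, ((P (s.map Prod.fst) : ℝ) : 𝕜) • x s

theorem levelSum_eq_weightedSum {D X : Type u} [NormedAddCommGroup X] [NormedSpace 𝕜 X]
    (ξ : Ordinal.{w}) (n i : ℕ) (x : List (Ordinal.{w} × D) → X) (t : List (Ordinal.{w} × D)) :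
    levelSum 𝕜 ξ n i x t = weightedSum 𝕜 (Lambda ξ n i) (prob ξ n) x t := rfl

theorem weightedSum_comp {Λ Λ' : Set (List Ordinal.{w})} {P P' : List Ordinal.{w} → ℝ}
    (x : List (Ordinal.{w} × D) → X) {t t' : List (Ordinal.{w} × D)}
    {φ : List (Ordinal.{w} × D) → List (Ordinal.{w} × D)} (hφ : Function.Injective φ)
    (h : ∀ s, s <+: t ∧ s.map Prod.fst ∈ Λ ↔ ∃ s', (s' <+: t' ∧ s'.map Prod.fst ∈ Λ') ∧ φ s' = s)
    (hP : ∀ s', s'.map Prod.fst ∈ Λ' → P ((φ s').map Prod.fst) = P' (s'.map Prod.fst)) :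
    weightedSum 𝕜 Λ P x t = weightedSum 𝕜 Λ' P' (fun s => x (φ s)) t' := by
  classical
  unfold weightedSum
  have : (t.inits.toFinset.filter (· ∈ dTree Λ D)) =
      (t'.inits.toFinset.filter (· ∈ dTree Λ' D)).image φ := by
    ext s
    simp only [Finset.mem_filter, Finset.mem_image, List.mem_toFinset, List.mem_inits]
    exact h s
  rw [this, Finset.sum_image (fun a _ b _ hab => hφ hab)]
  refine Finset.sum_congr rfl fun s hs => ?_
  rw [hP s (by simpa [dTree] using (Finset.mem_filter.1 hs).2)]

theorem weightedSum_first (x : List (Ordinal.{w} × D) → X) {t : List (Ordinal.{w} × D)}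
    (ht : t ∈ dTree (maxNodes (Gamma₁ ξ)) D) (r : List (Ordinal.{w} × D)) :
    weightedSum 𝕜 (Lambda ξ (n + 1) 1) (prob ξ (n + 1)) x
        (shiftD (Ordinal.omega0 ^ ξ * n) t ++ r) =
      weightedSum 𝕜 (Gamma₁ ξ) (prob₁ ξ) (fun s => x (shiftD (Ordinal.omega0 ^ ξ * n) s)) t := by
  refine weightedSum_comp x (shiftD_injective _) (fun s => ?_) (fun s hs => ?_)
  · rw [mem_Lambda_one]
    constructor
    · rintro ⟨h, u, hu, e⟩
      obtain ⟨s, rfl, rfl⟩ := exists_eq_shiftD e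
      refine ⟨s, ⟨prefix_of_maxNodes ht hu ?_, hu⟩, rfl⟩
      exact (List.prefix_or_prefix_of_prefix h (List.prefix_append _ _)).imp
        shiftD_prefix_shiftD.1 shiftD_prefix_shiftD.1
    · rintro ⟨s, ⟨h, hs⟩, rfl⟩
      exact ⟨(shiftD_prefix_shiftD.2 h).trans (List.prefix_append _ _), _, hs, by simp⟩
  · rw [map_fst_shiftD, prob_shift hs]

theorem weightedSum_later (hi : i < n) (x : List (Ordinal.{w} × D) → X)
    {t : List (Ordinal.{w} × D)} (ht : t ∈ dTree (maxNodes (Gamma₁ ξ)) D)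
    (r : List (Ordinal.{w} × D)) :
    weightedSum 𝕜 (Lambda ξ (n + 1) (i + 2)) (prob ξ (n + 1)) x
        (shiftD (Ordinal.omega0 ^ ξ * n) t ++ r) =
      weightedSum 𝕜 (Lambda ξ n (i + 1)) (prob ξ n)
        (fun s => x (shiftD (Ordinal.omega0 ^ ξ * n) t ++ s)) r := by
  refine weightedSum_comp x (List.append_right_injective _) (fun s => ?_) (fun s hs => ?_)
  · rw [mem_Lambda_succ]
    constructor
    · rintro ⟨h, u, hu, v, hv, e⟩
      obtain ⟨s₁, s₂, rfl, rfl, rfl⟩ := exists_eq_shiftD_append e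
      have hp := List.prefix_or_prefix_of_prefix ((List.prefix_append _ _).trans h)
        (List.prefix_append _ _)
      have e : s₁ = t := by
        refine (prefix_of_maxNodes ht hu.1 (hp.imp ?_ ?_)).eq_of_length_le
          (prefix_of_maxNodes hu ht.1 (hp.symm.imp ?_ ?_)).length_le <;>
        exact shiftD_prefix_shiftD.1
      subst e
      exact ⟨s₂, ⟨(List.prefix_append_right_inj _).1 h, hv⟩, rfl⟩
    · rintro ⟨s, ⟨h, hs⟩, rfl⟩
      exact ⟨(List.prefix_append_right_inj _).2 h, _, ht, _, hs, by simp⟩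
  · rw [List.map_append, map_fst_shiftD, prob_shift_append ht (Lambda_subset_Gamma hi hs)]

theorem weightedSum_limit (hξ : Order.IsSuccLimit ξ) (hζ : ζ < ξ)
    (x : List (Ordinal.{w} × D) → X) {t : List (Ordinal.{w} × D)}
    (ht : t ∈ dTree (Gamma₁ (ζ + 1)) D) :
    weightedSum 𝕜 (Gamma₁ ξ) (prob₁ ξ) x (shiftD (Ordinal.omega0 ^ ζ) t) =
      weightedSum 𝕜 (Gamma₁ (ζ + 1)) (prob₁ (ζ + 1))
        (fun s => x (shiftD (Ordinal.omega0 ^ ζ) s)) t := by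
  refine weightedSum_comp x (shiftD_injective _) (fun s => ?_) (fun s hs => ?_)
  · rw [mem_Gamma₁_limit hξ]
    constructor
    · rintro ⟨h, ζ', -, u, hu, e⟩
      obtain ⟨s, rfl, rfl⟩ := exists_eq_shiftD e
      obtain rfl : ζ' = ζ := by
        refine shift_index_eq_of_prefix hu ht ?_
        simpa using h.map Prod.fst
      exact ⟨s, ⟨shiftD_prefix_shiftD.1 h, hu⟩, rfl⟩
    · rintro ⟨s, ⟨h, hs⟩, rfl⟩
      exact ⟨shiftD_prefix_shiftD.2 h, ζ, hζ, _, hs, by simp⟩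
  · rw [map_fst_shiftD, prob₁_limit hξ hζ hs]

/-- Along a branch of `Γ_{ξ,n} ⊆ Γ_{ξ+1,1}`, the weighted sum of `Γ_{ξ+1,1}` is the average of the
`n` level sums of `Γ_{ξ,n}`. -/
theorem weightedSum_succ (x : List (Ordinal.{w} × D) → X) {t : List (Ordinal.{w} × D)}
    (ht : t ∈ dTree (Gamma ξ n) D) (hn : 1 ≤ n) :
    weightedSum 𝕜 (Gamma₁ (ξ + 1)) (prob₁ (ξ + 1)) x t =
      ∑ i : Fin n, ((1 / n : ℝ) : 𝕜) • weightedSum 𝕜 (Lambda ξ n (i + 1)) (prob ξ n) x t := by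
  classical
  simp only [weightedSum, Finset.sum_filter, Finset.smul_sum]
  rw [Finset.sum_comm]
  refine Finset.sum_congr rfl fun s hs => ?_
  have hst : s <+: t := by simpa using hs
  by_cases h : s ∈ dTree (Gamma₁ (ξ + 1)) D
  · obtain ⟨m, -, hm⟩ := mem_Gamma₁_succ.1 h
    obtain rfl := Gamma_index_eq_of_prefix hm ht (hst.map Prod.fst)
    obtain ⟨i, hi⟩ := exists_mem_Lambda hm
    rw [if_pos h, Finset.sum_eq_single i, if_pos (show s ∈ dTree (Lambda ξ m (i + 1)) D from hi), prob₁_succ hm,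
      smul_smul, ← RCLike.ofReal_mul, div_eq_inv_mul, one_div]
    · intro j _ hj
      rw [if_neg, smul_zero]
      intro hj'
      have := Lambda_index_unique hi hj'
      exact hj (Fin.ext (by omega))
    · simp
  · rw [if_neg h, Finset.sum_eq_zero]
    intro i _
    rw [if_neg, smul_zero]
    exact fun h' => h (Gamma_subset_Gamma₁_succ hn (Lambda_subset_Gamma i.2 h'))

theorem weightedSum_Gamma₁_zero (x : List (Ordinal.{w} × D) → X) (u : D) :
    weightedSum 𝕜 (Gamma₁ 0) (prob₁ 0) x [(0, u)] = x [(0, u)] := by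
  classical
  have : [(0, u)].inits = [[], [((0 : Ordinal.{w}), u)]] := rfl
  rw [weightedSum, Finset.sum_filter, this]
  simp [dTree, Gamma₁_zero, prob₁_zero]

/-- If the coefficients add up to `1` along the branches of `Γ_{ξ,1}`, they do so on every level
of the branches of `Γ_{ξ,n}`. -/
theorem weightedSum_Lambda_one_of
    (H : ∀ t ∈ dTree (maxNodes (Gamma₁ ξ)) D,
      weightedSum ℝ (Gamma₁ ξ) (prob₁ ξ) (fun _ => (1 : ℝ)) t = 1)
    {t : List (Ordinal.{w} × D)} (ht : t ∈ dTree (branches ξ n) D) (hi : i < n) :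
    weightedSum ℝ (Lambda ξ n (i + 1)) (prob ξ n) (fun _ => (1 : ℝ)) t = 1 := by
  induction n generalizing t i with
  | zero => omega
  | succ n ih =>
    obtain ⟨r, hr, s, hs, e⟩ := ht
    obtain ⟨r, s, rfl, rfl, rfl⟩ := exists_eq_shiftD_append e
    cases i with
    | zero => rw [zero_add, weightedSum_first _ hr, H r hr]
    | succ i => rw [weightedSum_later (by omega) _ hr, ih hs (by omega)]

theorem weightedSum_Gamma₁_one {t : List (Ordinal.{w} × D)}
    (ht : t ∈ dTree (maxNodes (Gamma₁ ξ)) D) :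
    weightedSum ℝ (Gamma₁ ξ) (prob₁ ξ) (fun _ => (1 : ℝ)) t = 1 := by
  induction ξ using Ordinal.limitRecOn generalizing t with
  | zero =>
    have ht : t.map Prod.fst = [0] := by simpa [Gamma₁_zero] using ht.1
    obtain ⟨a, rfl⟩ : ∃ a, t = [a] := List.length_eq_one_iff.1
      (by simpa using congrArg List.length ht)
    simp only [List.map_cons, List.map_nil, List.cons.injEq, and_true] at ht
    obtain ⟨a, u⟩ := a
    obtain rfl : a = 0 := ht
    exact weightedSum_Gamma₁_zero _ u
  | add_one ξ ih =>
    obtain ⟨n, hn, h⟩ := exists_mem_maxNodes_Gamma ht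
    rw [weightedSum_succ _ (show t ∈ dTree _ D from h.1) hn]
    rw [maxNodes_Gamma_eq hn] at h
    have : (n : ℝ) ≠ 0 := by positivity
    simp [weightedSum_Lambda_one_of (fun _ => ih) h, this]
  | limit ξ hξ ih =>
    obtain ⟨ζ, hζ, t', ht', e⟩ := (mem_maxNodes_Gamma₁_limit hξ).1 ht
    obtain ⟨t, rfl, rfl⟩ := exists_eq_shiftD e
    rw [weightedSum_limit hξ hζ _ ht'.1]
    exact ih _ (hξ.add_one_lt hζ) ht'

theorem weightedSum_Lambda_one {t : List (Ordinal.{w} × D)}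
    (ht : t ∈ dTree (branches ξ n) D) (hi : i < n) :
    weightedSum ℝ (Lambda ξ n (i + 1)) (prob ξ n) (fun _ => (1 : ℝ)) t = 1 :=
  weightedSum_Lambda_one_of (fun _ => weightedSum_Gamma₁_one) ht hi

/-- A weighted mean of vectors in the unit ball stays in the unit ball. -/
theorem norm_weightedSum_le {Λ : Set (List Ordinal.{w})} {P : List Ordinal.{w} → ℝ}
    {x : List (Ordinal.{w} × D) → X} {t : List (Ordinal.{w} × D)} (hP : ∀ s ∈ Λ, 0 ≤ P s)
    (h1 : weightedSum ℝ Λ P (fun _ => (1 : ℝ)) t = 1) (hx : ∀ s ∈ dTree Λ D, ‖x s‖ ≤ 1) :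
    ‖weightedSum 𝕜 Λ P x t‖ ≤ 1 := by
  classical
  rw [← h1]
  refine (norm_sum_le _ _).trans (Finset.sum_le_sum fun s hs => ?_)
  have hs' := (Finset.mem_filter.1 hs).2
  rw [norm_smul, RCLike.norm_ofReal, abs_of_nonneg (hP _ hs')]
  exact mul_le_mul_of_nonneg_left (hx s hs') (hP _ hs')

/-- A functional that is at least `c` at every vector is at least `c` at their weighted mean. -/
theorem le_re_weightedSum {Λ : Set (List Ordinal.{w})} {P : List Ordinal.{w} → ℝ}
    {x : List (Ordinal.{w} × D) → X} {t : List (Ordinal.{w} × D)} (hP : ∀ s ∈ Λ, 0 ≤ P s)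
    (h1 : weightedSum ℝ Λ P (fun _ => (1 : ℝ)) t = 1) (f : WeakDual 𝕜 X) {c : ℝ}
    (hf : ∀ s ∈ dTree Λ D, s <+: t → c ≤ RCLike.re (f (x s))) :
    c ≤ RCLike.re (f (weightedSum 𝕜 Λ P x t)) := by
  classical
  have hc : c = weightedSum ℝ Λ P (fun _ => (1 : ℝ)) t * c := by rw [h1, one_mul]
  rw [hc]
  simp only [weightedSum]
  rw [map_sum, map_sum, Finset.sum_mul]
  refine Finset.sum_le_sum fun s hs => ?_
  obtain ⟨hs1, hs2⟩ := Finset.mem_filter.1 hs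
  simp only [map_smul, smul_eq_mul, RCLike.re_ofReal_mul, mul_one, RCLike.ofReal_real_eq_id, id]
  exact mul_le_mul_of_nonneg_left (hf s hs2 (by simpa using hs1)) (hP _ hs2)

end Trees

/-! ### From weakly null trees to non-empty derivations -/

section Descent

variable {𝕜 : Type v} [RCLike 𝕜] {X : Type u} [NormedAddCommGroup X] [NormedSpace 𝕜 X]
  {ξ ζ : Ordinal.{w}}

theorem IsWeaklyNull.comp_shift {D : Type u} [Preorder D] {T T' : Set (List Ordinal.{w})}
    {x : List (Ordinal.{w} × D) → X} (h : IsWeaklyNull 𝕜 T x) (ζ : Ordinal.{w})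
    (hT : ∀ s ∈ T', shift ζ s ∈ T) : IsWeaklyNull 𝕜 T' (fun s => x (shiftD ζ s)) := by
  intro t η ht
  have := h (shiftD ζ t) (ζ + η) (by simpa [shift] using hT _ ht)
  simpa [shiftD] using this

theorem IsWeaklyNull.comp_append {D : Type u} [Preorder D] {T T' : Set (List Ordinal.{w})}
    {x : List (Ordinal.{w} × D) → X} (h : IsWeaklyNull 𝕜 T x) (p : List (Ordinal.{w} × D))
    (hT : ∀ s ∈ T', p.map Prod.fst ++ s ∈ T) : IsWeaklyNull 𝕜 T' (fun s => x (p ++ s)) := by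
  intro t η ht
  have := h (p ++ t) η (by simpa using hT _ ht)
  simpa using this

theorem IsWeaklyNull.mono {D : Type u} [Preorder D] {T T' : Set (List Ordinal.{w})}
    {x : List (Ordinal.{w} × D) → X} (h : IsWeaklyNull 𝕜 T x) (hT : T' ⊆ T) :
    IsWeaklyNull 𝕜 T' x := fun t ζ ht => h t ζ (hT ht)

theorem IsWeaklyNull.const_smul {D : Type u} [Preorder D] {T : Set (List Ordinal.{w})}
    {x : List (Ordinal.{w} × D) → X} (h : IsWeaklyNull 𝕜 T x) (c : 𝕜) :
    IsWeaklyNull 𝕜 T (fun s => c • x s) := by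
  intro t ζ ht
  have := (h t ζ ht).const_smul c
  simpa using this

theorem weightedSum_smul {D : Type*} (Λ : Set (List Ordinal.{w})) (P : List Ordinal.{w} → ℝ)
    (x : List (Ordinal.{w} × D) → X) (t : List (Ordinal.{w} × D)) (c : 𝕜) :
    weightedSum 𝕜 Λ P (fun s => c • x s) t = c • weightedSum 𝕜 Λ P x t := by
  simp only [weightedSum, Finset.smul_sum]
  exact Finset.sum_congr rfl fun s _ => smul_comm _ _ _

/-- A point `f` of `S` lies in `s_ε(S)` if it is the weak* limit of points of `S` that differ from
`f` by at least `ε' > ε` at vectors of the unit ball. -/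
theorem mem_derivative_of_tendsto {α : Type*} {l : Filter α} [l.NeBot]
    {S : Set (WeakDual 𝕜 X)} {f : WeakDual 𝕜 X} (hf : f ∈ S) {g : α → WeakDual 𝕜 X}
    {x : α → X} {ε ε' : ℝ} (hε : ε < ε') (hε0 : 0 ≤ ε) (hg : Tendsto g l (𝓝 f))
    (hgS : ∀ᶠ i in l, g i ∈ S)
    (hx : ∀ᶠ i in l, ‖x i‖ ≤ 1) (h : ∀ᶠ i in l, ε' ≤ RCLike.re (g i (x i)) - RCLike.re (f (x i))) :
    f ∈ derivative ε S := by
  refine ⟨hf, fun V hV => ?_⟩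
  obtain ⟨i, hi1, hi2, hi3, hi4⟩ := ((hg.eventually hV).and (hgS.and (hx.and h))).exists
  have h1 : edist (WeakDual.toStrongDual (g i)) (WeakDual.toStrongDual f) ≤
      Metric.ediam (WeakDual.toStrongDual '' (V ∩ S)) :=
    Metric.edist_le_ediam_of_mem (mem_image_of_mem _ ⟨hi1, hi2⟩)
      (mem_image_of_mem _ ⟨mem_of_mem_nhds hV, hf⟩)
  refine lt_of_lt_of_le ?_ h1
  rw [edist_dist, ENNReal.ofReal_lt_ofReal_iff_of_nonneg hε0, dist_eq_norm]
  refine hε.trans_le (hi4.trans ?_)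
  rw [← map_sub]
  calc RCLike.re (g i (x i) - f (x i)) ≤ ‖g i (x i) - f (x i)‖ := RCLike.re_le_norm _
    _ = ‖(WeakDual.toStrongDual (g i) - WeakDual.toStrongDual f) (x i)‖ := rfl
    _ ≤ _ := (ContinuousLinearMap.le_opNorm _ _).trans
      (mul_le_of_le_one_right (norm_nonneg _) hi3)

variable (𝕜 X) in
/-- If every maximal node `t` of `Γ_{ξ,1}.D` carries one of finitely many colours `c` and a
functional `g` in the compact set `S c` with `ρ c ≤ Re g (∑ ℙ(s) x_s)`, then
`s^{ω^ξ}_{ρ c - δ}(S c)` is non-empty for some colour `c`. -/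
def LevelProperty (ξ : Ordinal.{w}) : Prop :=
  ∀ (R δ : ℝ), 0 ≤ R → 0 < δ → ∀ (D : Type u) [Preorder D] [IsDirectedOrder D] [Nonempty D]
    (x : List (Ordinal.{w} × D) → X) (C : Type) [Finite C] (S : C → Set (WeakDual 𝕜 X))
    (ρ : C → ℝ),
    (∀ t ∈ dTree (Gamma₁ ξ) D, ‖x t‖ ≤ 1) → IsWeaklyNull 𝕜 (Gamma₁ ξ) x →
    (∀ c, IsCompact (S c)) → (∀ c, ∀ g ∈ S c, ∀ y, ‖g y‖ ≤ R * ‖y‖) →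
    (∀ t ∈ dTree (maxNodes (Gamma₁ ξ)) D, ∃ c, ∃ g ∈ S c,
      ρ c ≤ RCLike.re (g (weightedSum 𝕜 (Gamma₁ ξ) (prob₁ ξ) x t))) →
    ∃ c, (iterDerivative (ρ c - δ) (Ordinal.omega0 ^ ξ) (S c)).Nonempty

theorem levelProperty_zero : LevelProperty 𝕜 X (0 : Ordinal.{w}) := by
  intro R δ _ hδ D _ _ _ x C _ S ρ hx hnull hS _ h
  have hmem : ∀ u : D, [((0 : Ordinal.{w}), u)] ∈ dTree (maxNodes (Gamma₁ 0)) D := by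
    intro u
    simp [dTree, maxNodes, Gamma₁_zero]
  have h' : ∀ u : D, ∃ c, ∃ g ∈ S c, ρ c ≤ RCLike.re (g (x [(0, u)])) := fun u => by
    simpa only [weightedSum_Gamma₁_zero] using h _ (hmem u)
  choose c g hgS hg using h'
  -- along an ultrafilter the colour is constant and the functionals converge
  let 𝒰 : Ultrafilter D := Ultrafilter.of atTop
  obtain ⟨c₀, hc₀⟩ := (𝒰.map c).eq_pure_of_finite
  have hc : ∀ᶠ u in 𝒰, c u = c₀ := by
    have : {c₀} ∈ 𝒰.map c := by
      rw [hc₀]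
      exact mem_pure.2 rfl
    exact this
  have hgS' : ∀ᶠ u in 𝒰, g u ∈ S c₀ := hc.mono fun u hu => hu ▸ hgS u
  obtain ⟨f, hf, hlim⟩ := (hS c₀).ultrafilter_le_nhds (𝒰.map g) (le_principal_iff.2 hgS')
  refine ⟨c₀, f, ?_⟩
  rcases le_or_gt (ρ c₀ - δ) 0 with h0 | h0
  · rwa [iterDerivative_of_nonpos h0]
  rw [Ordinal.opow_zero, ← zero_add (1 : Ordinal.{w}), iterDerivative_add_one h0,
    iterDerivative_zero]
  have hnull' : Tendsto (fun u : D => RCLike.re (f (x [(0, u)]))) 𝒰 (𝓝 0) := by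
    have h1 := hnull [] 0 (by simp [Gamma₁_zero])
    have h2 : Continuous fun y : WeakSpace 𝕜 X => RCLike.re (f y) :=
      RCLike.continuous_re.comp
        (WeakBilin.eval_continuous (topDualPairing 𝕜 X).flip (WeakDual.toStrongDual f))
    have h3 := (h2.tendsto 0).comp h1
    have h4 : RCLike.re (f (0 : X)) = 0 := by simp
    exact (show Tendsto _ _ (𝓝 (RCLike.re (f (0 : X)))) from h3).mono_left
      (Ultrafilter.of_le atTop) |>.trans (by rw [h4])
  refine mem_derivative_of_tendsto (l := (𝒰 : Filter D)) hf (ε' := ρ c₀ - δ / 2) (g := g)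
    (x := fun u => x [(0, u)]) (by linarith) h0.le hlim hgS' (.of_forall fun u => ?_) ?_
  · exact hx _ (hmem u).1
  · filter_upwards [hc, hnull'.eventually_lt_const (half_pos hδ)] with u hu hu'
    have := hg u
    rw [hu] at this
    linarith

theorem exists_eq_norm_smul (a : 𝕜) : ∃ u : 𝕜, ‖u‖ = 1 ∧ a = (‖a‖ : 𝕜) * u := by
  rcases eq_or_ne a 0 with rfl | h
  · exact ⟨1, by simp⟩
  · have : (‖a‖ : 𝕜) ≠ 0 := by simpa using h
    exact ⟨a / ‖a‖, by simp [h], by field_simp⟩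

/-- The several-level form of `LevelProperty`. The numbers `ε_i = k_i δ` are taken from a finite
grid, so that a node of the first level can be coloured by the numbers belonging to the tree above
it. -/
theorem LevelProperty.foldDerivative_nonempty (H : LevelProperty 𝕜 X ξ) {R δ : ℝ} (hR0 : 0 ≤ R)
    (hδ : 0 < δ)
    {N : ℕ} (hN : R + 2 * δ ≤ N * δ) (n : ℕ) {D : Type u} [Preorder D] [IsDirectedOrder D]
    [Nonempty D] (x : List (Ordinal.{w} × D) → X) (C : Type) [Finite C]
    (S : C → Set (WeakDual 𝕜 X)) (ρ : C → ℝ) (a : Fin n → 𝕜)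
    (hx : ∀ t ∈ dTree (Gamma ξ n) D, ‖x t‖ ≤ 1) (hnull : IsWeaklyNull 𝕜 (Gamma ξ n) x)
    (hS : ∀ c, IsCompact (S c)) (hR : ∀ c, ∀ g ∈ S c, ∀ y, ‖g y‖ ≤ R * ‖y‖)
    (h : ∀ t ∈ dTree (branches ξ n) D, ∃ c, ∃ g ∈ S c, ρ c ≤
      ∑ i : Fin n, RCLike.re (g (a i • weightedSum 𝕜 (Lambda ξ n (i + 1)) (prob ξ n) x t))) :
    ∃ c, ∃ k : Fin n → Icc (-N : ℤ) N, ρ c ≤ ∑ i, ‖a i‖ * ((((k i : ℤ) : ℝ) + 2) * δ) ∧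
      (foldDerivative (Ordinal.omega0 ^ ξ)
        (List.ofFn fun i => ((k i : ℤ) : ℝ) * δ) (S c)).Nonempty := by
  induction n generalizing x C with
  | zero =>
    obtain ⟨c, g, hg, hρ⟩ := h [] rfl
    exact ⟨c, Fin.elim0, by simpa using hρ, g, by simpa using hg⟩
  | succ n ih =>
    set β := Ordinal.omega0 ^ ξ with hβ
    obtain ⟨u, hu, ha0⟩ := exists_eq_norm_smul (a 0)
    let y : List (Ordinal.{w} × D) → X := fun s => u • x (shiftD (β * n) s)
    have hy : ∀ t ∈ dTree (Gamma₁ ξ) D, ‖y t‖ ≤ 1 := by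
      intro t ht
      rw [norm_smul, hu, one_mul]
      refine hx _ ?_
      change (shiftD _ t).map Prod.fst ∈ Gamma ξ (n + 1)
      rw [map_fst_shiftD]
      exact mem_Gamma_succ.2 (Or.inl ⟨t.map Prod.fst, ht, rfl⟩)
    let z : List (Ordinal.{w} × D) → X := weightedSum 𝕜 (Gamma₁ ξ) (prob₁ ξ) y
    have hz : ∀ t ∈ dTree (maxNodes (Gamma₁ ξ)) D, ‖z t‖ ≤ 1 := fun t ht =>
      norm_weightedSum_le (fun s hs => prob₁_nonneg hs) (weightedSum_Gamma₁_one ht) hy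
    -- the colours of the nodes of the first level
    let C₁ := C × Icc (1 - N : ℤ) N
    let ρ₁ : C₁ → ℝ := fun p => ρ p.1 - ‖a 0‖ * (((p.2 : ℤ) + 1 : ℝ) * δ)
    have key : ∀ t ∈ dTree (maxNodes (Gamma₁ ξ)) D, ∃ p : C₁, ∃ k : Fin n → Icc (-N : ℤ) N,
        ρ₁ p ≤ ∑ i, ‖a i.succ‖ * ((((k i : ℤ) : ℝ) + 2) * δ) ∧
        (foldDerivative β (List.ofFn fun i => ((k i : ℤ) : ℝ) * δ)
          (S p.1 ∩ {g | ((p.2 : ℤ) : ℝ) * δ ≤ RCLike.re (g (z t))})).Nonempty := by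
      intro t ht
      have hclosed : ∀ b : ℝ, IsClosed {g : WeakDual 𝕜 X | b ≤ RCLike.re (g (z t))} := fun b =>
        isClosed_le continuous_const (RCLike.continuous_re.comp (WeakDual.eval_continuous _))
      refine ih (fun s => x (shiftD (β * n) t ++ s)) C₁
        (fun p : C₁ => S p.1 ∩ {g | ((p.2 : ℤ) : ℝ) * δ ≤ RCLike.re (g (z t))}) ρ₁
        (fun i => a i.succ) ?_ ?_ (fun p => (hS p.1).inter_right (hclosed _))
        (fun p g hg => hR p.1 g hg.1) ?_
      · intro s hs
        refine hx _ ?_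
        change (shiftD _ t ++ s).map Prod.fst ∈ Gamma ξ (n + 1)
        rw [List.map_append, map_fst_shiftD]
        exact mem_Gamma_succ.2 (Or.inr ⟨_, ht, _, hs, rfl⟩)
      · refine hnull.comp_append _ fun s hs => ?_
        rw [map_fst_shiftD]
        exact mem_Gamma_succ.2 (Or.inr ⟨_, ht, _, hs, rfl⟩)
      · intro r hr
        obtain ⟨c, g, hg, hρ⟩ := h (shiftD (β * n) t ++ r) ⟨_, ht, _, hr, by simp [hβ]⟩
        have hb : |RCLike.re (g (z t))| ≤ R := (RCLike.abs_re_le_norm _).trans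
          ((hR c g hg _).trans (mul_le_of_le_one_right hR0 (hz t ht)))
        obtain ⟨hb1, hb2⟩ := abs_le.1 hb
        set κ := RCLike.re (g (z t)) with hκ
        have hk1 : ⌊κ / δ⌋ ≤ (N : ℤ) := by
          have : κ / δ ≤ N := by
            rw [div_le_iff₀ hδ]
            linarith
          exact_mod_cast (Int.floor_le _).trans this
        have hk2 : (1 - N : ℤ) ≤ ⌊κ / δ⌋ := by
          rw [Int.le_floor, le_div_iff₀ hδ]
          push_cast
          linarith
        have hk3 : (⌊κ / δ⌋ : ℝ) * δ ≤ κ := (le_div_iff₀ hδ).1 (Int.floor_le _)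
        have hk4 : κ ≤ ((⌊κ / δ⌋ : ℝ) + 1) * δ := ((div_lt_iff₀ hδ).1 (Int.lt_floor_add_one _)).le
        refine ⟨(c, ⟨⌊κ / δ⌋, hk2, hk1⟩), g, ⟨hg, hk3⟩, ?_⟩
        rw [Fin.sum_univ_succ] at hρ
        simp only [Fin.val_succ, Fin.val_zero, zero_add] at hρ
        have e0 : RCLike.re (g (a 0 • weightedSum 𝕜 (Lambda ξ (n + 1) 1) (prob ξ (n + 1)) x
            (shiftD (β * n) t ++ r))) = ‖a 0‖ * κ := by
          rw [hβ, weightedSum_first x ht r]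
          conv_lhs => rw [ha0, mul_smul, ← weightedSum_smul, map_smul, smul_eq_mul,
            RCLike.re_ofReal_mul]
        rw [e0] at hρ
        have e1 : ∀ i : Fin n, weightedSum 𝕜 (Lambda ξ (n + 1) ((i : ℕ) + 1 + 1)) (prob ξ (n + 1)) x
            (shiftD (β * n) t ++ r) = weightedSum 𝕜 (Lambda ξ n (i + 1)) (prob ξ n)
              (fun s => x (shiftD (β * n) t ++ s)) r := fun i => weightedSum_later i.2 x ht r
        simp only [e1] at hρ
        have := mul_le_mul_of_nonneg_left hk4 (norm_nonneg (a 0))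
        simp only [ρ₁]
        linarith
    -- the colours of the branches of the first level
    let C₂ := {p : C₁ × (Fin n → Icc (-N : ℤ) N) //
      ρ₁ p.1 ≤ ∑ i, ‖a i.succ‖ * ((((p.2 i : ℤ) : ℝ) + 2) * δ)}
    obtain ⟨⟨⟨⟨c, k₀⟩, k⟩, hk⟩, hne⟩ := H R δ hR0 hδ D y C₂
      (fun p => foldDerivative β (List.ofFn fun i => ((p.1.2 i : ℤ) : ℝ) * δ) (S p.1.1.1))
      (fun p => ((p.1.1.2 : ℤ) : ℝ) * δ) hy
      ((hnull.comp_shift (β * n) fun s hs => mem_Gamma_succ.2 (Or.inl ⟨_, hs, rfl⟩)).const_smul u)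
      (fun p => isCompact_foldDerivative (hS _) _ _)
      (fun p g hg => hR _ g (foldDerivative_subset _ _ _ hg)) (fun t ht => by
        obtain ⟨p, k, hk, g, hg⟩ := key t ht
        exact ⟨⟨(p, k), hk⟩, g, foldDerivative_mono _ _ inter_subset_left hg,
          (foldDerivative_subset _ _ _ hg).2⟩)
    refine ⟨c, Fin.cons ⟨k₀ - 1, by have := k₀.2.1; grind, by have := k₀.2.2; grind⟩ k, ?_, ?_⟩
    · rw [Fin.sum_univ_succ]
      simp only [ρ₁] at hk
      simp only [Fin.cons_zero, Fin.cons_succ, Int.cast_sub, Int.cast_one]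
      have e : (((k₀ : ℤ) : ℝ) - 1 + 2) = (k₀ : ℤ) + 1 := by ring
      rw [e]
      linarith
    · rw [List.ofFn_succ]
      simp only [Fin.cons_zero, Fin.cons_succ, Int.cast_sub, Int.cast_one, sub_mul, one_mul]
      exact hne

theorem iterDerivative_opow_succ_nonempty {S : Set (WeakDual 𝕜 X)} (hS : IsCompact S) {ε : ℝ}
    (h : ∀ m : ℕ, (iterDerivative ε (Ordinal.omega0 ^ ξ * m) S).Nonempty) :
    (iterDerivative ε (Ordinal.omega0 ^ (ξ + 1)) S).Nonempty := by
  have hlim : Order.IsSuccLimit (Ordinal.omega0 ^ (ξ + 1)) :=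
    Ordinal.isSuccLimit_opow_left Ordinal.isSuccLimit_omega0 (by simp)
  refine iterDerivative_limit_nonempty hS hlim fun ζ hζ => ?_
  rw [Ordinal.opow_add, Ordinal.opow_one,
    Ordinal.lt_mul_iff_of_isSuccLimit Ordinal.isSuccLimit_omega0] at hζ
  obtain ⟨o, ho, hζ⟩ := hζ
  obtain ⟨m, rfl⟩ := Ordinal.lt_omega0.1 ho
  exact (h m).mono (iterDerivative_anti _ _ hζ.le)

theorem iterDerivative_opow_limit_nonempty {S : Set (WeakDual 𝕜 X)} (hS : IsCompact S) {ε : ℝ}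
    (hξ : Order.IsSuccLimit ξ)
    (h : ∀ ζ < ξ, (iterDerivative ε (Ordinal.omega0 ^ ζ) S).Nonempty) :
    (iterDerivative ε (Ordinal.omega0 ^ ξ) S).Nonempty := by
  have hlim : Order.IsSuccLimit (Ordinal.omega0 ^ ξ) :=
    Ordinal.isSuccLimit_opow Ordinal.one_lt_omega0 hξ
  refine iterDerivative_limit_nonempty hS hlim fun o ho => ?_
  obtain ⟨ζ, hζ, ho⟩ := (Ordinal.lt_opow_of_isSuccLimit Ordinal.omega0_ne_zero hξ).1 ho
  exact (h ζ hζ).mono (iterDerivative_anti _ _ ho.le)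

theorem sum_le_length_mul_add_countP_mul (l : List ℝ) {η B : ℝ} (hη : 0 ≤ η)
    (hl : ∀ ε ∈ l, ε ≤ B) :
    l.sum ≤ l.length * η + (l.countP (fun ε => decide (η ≤ ε)) : ℕ) * B := by
  induction l with
  | nil => simp
  | cons ε l ih =>
    have h1 := ih fun ε hε => hl ε (by simp [hε])
    have h2 := hl ε (by simp)
    by_cases h : η ≤ ε
    · rw [List.countP_cons_of_pos (by simpa using h), List.sum_cons, List.length_cons]
      push_cast
      linarith
    · rw [List.countP_cons_of_neg (by simpa using h), List.sum_cons, List.length_cons]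
      push_cast
      linarith

/-- A branch of `Γ_{ξ+1,1}` through `Γ_{ξ,n}` gives `n` derivations whose `ε_i` have mean at least
about `ρ`; as they are bounded, a fixed proportion of them is at least `ρ - δ`, so the number of
derivations of order `ω ^ ξ` with `ε = ρ - δ` is unbounded as `n` grows. -/
theorem LevelProperty.succ (H : LevelProperty 𝕜 X ξ) : LevelProperty 𝕜 X (ξ + 1) := by
  intro R δ hR0 hδ D _ _ _ x C _ S ρ hx hnull hS hR h
  by_contra! hne
  have hm : ∀ c, ∃ m : ℕ, iterDerivative (ρ c - δ) (Ordinal.omega0 ^ ξ * m) (S c) = ∅ := by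
    intro c
    by_contra! hc
    exact (iterDerivative_opow_succ_nonempty (hS c) hc).ne_empty (hne c)
  choose m hm using hm
  obtain ⟨M, hM⟩ := Set.finite_range m |>.bddAbove
  have hM : ∀ c, m c ≤ M := fun c => hM (mem_range_self c)
  obtain ⟨N, hN⟩ := exists_nat_ge ((R + 2 * (δ / 4)) / (δ / 4))
  have hδ' : 0 < δ / 4 := by positivity
  rw [div_le_iff₀ hδ'] at hN
  obtain ⟨n, hn⟩ := exists_nat_gt (M * (N * (δ / 4)) / (δ / 2))
  rw [div_lt_iff₀ (by positivity)] at hn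
  have hn1 : 1 ≤ n := by
    rcases Nat.eq_zero_or_pos n with rfl | h
    · have : 0 ≤ M * (N * (δ / 4)) := by positivity
      simp at hn
      linarith
    · exact h
  have hn0 : (0 : ℝ) < n := by exact_mod_cast hn1
  obtain ⟨c, k, hk, hfold⟩ := H.foldDerivative_nonempty hR0 hδ' hN n x C S ρ
    (fun _ => ((1 / n : ℝ) : 𝕜)) (fun t ht => hx t (Gamma_subset_Gamma₁_succ hn1 ht))
    (hnull.mono (Gamma_subset_Gamma₁_succ hn1)) hS hR (fun t ht => by
      rw [← maxNodes_Gamma_eq hn1] at ht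
      obtain ⟨c, g, hg, hρ⟩ := h t (maxNodes_Gamma_subset hn1 ht)
      refine ⟨c, g, hg, hρ.trans_eq ?_⟩
      rw [weightedSum_succ _ ht.1 hn1, map_sum, map_sum])
  -- for `ρ c ≤ δ` the derivation is `S c` itself
  rcases le_or_gt (ρ c - δ) 0 with h0 | h0
  · have := hne c
    rw [iterDerivative_of_nonpos h0] at this
    exact (hfold.mono (foldDerivative_subset _ _ _)).ne_empty this
  have hcount := hfold.mono (foldDerivative_subset_count _ _ _ (ρ c - δ))
  set l := List.ofFn fun i => ((k i : ℤ) : ℝ) * (δ / 4) with hl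
  set j := l.countP (fun ε => decide (ρ c - δ ≤ ε)) with hj
  have hjM : j ≤ M := by
    by_contra! hlt
    refine (hcount.mono (iterDerivative_anti _ _ ?_)).ne_empty (hm c)
    have : ((m c : ℕ) : Ordinal.{w}) ≤ j := by exact_mod_cast (hM c).trans hlt.le
    exact mul_le_mul_right this _
  have hsum := sum_le_length_mul_add_countP_mul l h0.le (B := N * (δ / 4)) (by
    intro ε hε
    obtain ⟨i, rfl⟩ := List.mem_ofFn.1 hε
    have : ((k i : ℤ) : ℝ) ≤ N := by exact_mod_cast (k i).2.2
    exact mul_le_mul_of_nonneg_right this hδ'.le)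
  rw [← hj] at hsum
  have hk' : n * ρ c ≤ l.sum + n * (2 * (δ / 4)) := by
    have e : ∑ i : Fin n, ‖((1 / n : ℝ) : 𝕜)‖ * ((((k i : ℤ) : ℝ) + 2) * (δ / 4)) =
        (1 / n) * (l.sum + n * (2 * (δ / 4))) := by
      rw [← Finset.mul_sum, hl, List.sum_ofFn]
      simp [add_mul, Finset.sum_add_distrib]
    rw [e] at hk
    calc n * ρ c ≤ n * ((1 / n) * (l.sum + n * (2 * (δ / 4)))) := by gcongr
      _ = _ := by field_simp
  have hlen : l.length = n := by simp [hl]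
  rw [hlen] at hsum
  have : (j : ℝ) * (N * (δ / 4)) ≤ M * (N * (δ / 4)) :=
    mul_le_mul_of_nonneg_right (by exact_mod_cast hjM) (by positivity)
  linarith

/-- If each colour had an empty derivation of some order `ω ^ ζ` with `ζ < ξ`, then, the colours
being finitely many, one `ζ < ξ` would do for all of them, against the property for the copy of
`Γ_{ζ+1,1}` in `Γ_{ξ,1}`. -/
theorem levelProperty_limit (hξ : Order.IsSuccLimit ξ) (H : ∀ ζ < ξ, LevelProperty 𝕜 X (ζ + 1)) :
    LevelProperty 𝕜 X ξ := by
  intro R δ hR0 hδ D _ _ _ x C _ S ρ hx hnull hS hR h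
  by_contra! hne
  have hm : ∀ c, ∃ ζ < ξ, iterDerivative (ρ c - δ) (Ordinal.omega0 ^ ζ) (S c) = ∅ := by
    intro c
    by_contra! hc
    exact (iterDerivative_opow_limit_nonempty (hS c) hξ hc).ne_empty (hne c)
  choose o ho hm using hm
  obtain ⟨ζ, hζ, hle⟩ : ∃ ζ < ξ, ∀ c, o c ≤ ζ := by
    rcases isEmpty_or_nonempty C with hC | hC
    · exact ⟨0, hξ.bot_lt, fun c => (IsEmpty.false c).elim⟩
    · obtain ⟨c, hc⟩ := Finite.exists_max o
      exact ⟨o c, ho c, hc⟩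
  have hmem : ∀ s ∈ Gamma₁ (ζ + 1), shift (Ordinal.omega0 ^ ζ) s ∈ Gamma₁ ξ := fun s hs =>
    (mem_Gamma₁_limit hξ).2 ⟨ζ, hζ, s, hs, rfl⟩
  obtain ⟨c, hc⟩ := H ζ hζ R δ hR0 hδ D (fun s => x (shiftD (Ordinal.omega0 ^ ζ) s)) C S ρ
    (fun t ht => hx _ (by
      change (shiftD _ t).map Prod.fst ∈ Gamma₁ ξ
      rw [map_fst_shiftD]
      exact hmem _ ht))
    (hnull.comp_shift _ hmem) hS hR (fun t ht => by
      obtain ⟨c, g, hg, hρ⟩ := h (shiftD (Ordinal.omega0 ^ ζ) t) (by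
        change (shiftD _ t).map Prod.fst ∈ maxNodes (Gamma₁ ξ)
        rw [map_fst_shiftD]
        exact (mem_maxNodes_Gamma₁_limit hξ).2 ⟨ζ, hζ, _, ht, rfl⟩)
      exact ⟨c, g, hg, by rwa [weightedSum_limit hξ hζ x ht.1] at hρ⟩)
  refine (hc.mono (iterDerivative_anti _ _ ?_)).ne_empty (hm c)
  exact Ordinal.opow_le_opow_right Ordinal.omega0_pos ((hle c).trans le_self_add)

theorem levelProperty (ξ : Ordinal.{w}) : LevelProperty 𝕜 X ξ := by
  induction ξ using WellFoundedLT.induction with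
  | ind ξ ih =>
    rcases Ordinal.zero_or_succ_or_isSuccLimit ξ with rfl | ⟨ζ, rfl⟩ | hξ
    · exact levelProperty_zero
    · exact (ih ζ (by simp)).succ
    · exact levelProperty_limit hξ fun ζ hζ => ih _ (hξ.add_one_lt hζ)

end Descent

/-! ### From non-empty derivations to weakly null trees -/

section Ascent

variable {𝕜 : Type v} [RCLike 𝕜] {X : Type u} [NormedAddCommGroup X] [NormedSpace 𝕜 X]
  {ξ ζ : Ordinal.{w}}

theorem exists_re_gt_of_lt_norm (h : StrongDual 𝕜 X) {r : ℝ} (hr : 0 ≤ r) (hh : r < ‖h‖) :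
    ∃ x : X, ‖x‖ ≤ 1 ∧ r < RCLike.re (h x) := by
  obtain ⟨x, hx⟩ : ∃ x, r * ‖x‖ < ‖h x‖ := by
    by_contra! hc
    exact hh.not_ge (h.opNorm_le_bound hr hc)
  have hx0 : 0 < ‖x‖ := by
    refine lt_of_le_of_ne (norm_nonneg _) fun h0 => ?_
    rw [← h0, mul_zero, norm_eq_zero.1 h0.symm, map_zero, norm_zero] at hx
    exact lt_irrefl _ hx
  obtain ⟨u, hu, e⟩ := exists_eq_norm_smul (h x)
  have hu0 : u ≠ 0 := by
    rintro rfl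
    simp at hu
  refine ⟨(((‖x‖⁻¹ : ℝ) : 𝕜) * u⁻¹) • x, ?_, ?_⟩
  · rw [norm_smul, norm_mul, norm_inv, hu, RCLike.norm_ofReal, abs_of_pos (inv_pos.2 hx0)]
    simp [hx0.ne']
  · have : h ((((‖x‖⁻¹ : ℝ) : 𝕜) * u⁻¹) • x) = ((‖x‖⁻¹ * ‖h x‖ : ℝ) : 𝕜) := by
      rw [map_smul, smul_eq_mul]
      conv_lhs => rw [e]
      push_cast
      field_simp
    rw [this, RCLike.ofReal_re, inv_mul_eq_div, lt_div_iff₀ hx0]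
    exact hx

theorem exists_norm_sub_gt {ε : ℝ} {S : Set (WeakDual 𝕜 X)} {g : WeakDual 𝕜 X}
    (hg : g ∈ derivative ε S) {V : Set (WeakDual 𝕜 X)} (hV : V ∈ 𝓝 g) :
    ∃ y ∈ V ∩ S, ε / 2 < ‖WeakDual.toStrongDual y - WeakDual.toStrongDual g‖ := by
  by_contra! h
  refine (hg.2 V hV).not_ge (Metric.ediam_le ?_)
  rintro _ ⟨y, hy, rfl⟩ _ ⟨y', hy', rfl⟩
  rw [edist_dist]
  refine ENNReal.ofReal_le_ofReal ((dist_triangle_right _ _ (WeakDual.toStrongDual g)).trans ?_)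
  rw [dist_eq_norm, dist_eq_norm]
  linarith [h y hy, h y' hy']

theorem tendsto_toWeakSpace {α : Type*} {l : Filter α} {x : α → X}
    (h : ∀ f : StrongDual 𝕜 X, Tendsto (fun i => f (x i)) l (𝓝 0)) :
    Tendsto (fun i => toWeakSpace 𝕜 X (x i)) l (𝓝 0) := by
  rw [(show Topology.IsInducing fun (y : WeakSpace 𝕜 X) f => (topDualPairing 𝕜 X).flip y f from
    ⟨rfl⟩).tendsto_nhds_iff, tendsto_pi_nhds]
  intro f
  have : (topDualPairing 𝕜 X).flip (0 : X) f = 0 := by simp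
  exact (h f).trans (by rw [← this]; rfl)

/-- Near a point `g` of `s_ε(S)` there are `y ∈ S` that are large at weakly small vectors of the
unit ball. The vector is half a difference `x - x'`, where `(y, x)` and `(y', x')` run along an
ultrafilter of pairs with `y → g` and `Re (y - g)(x) > ε / 2`: such differences are weakly null,
and `(y - g)(x')` tends to `0` for fixed `x'`. -/
theorem exists_large_of_mem_derivative {ε : ℝ} (hε : 0 < ε) {S : Set (WeakDual 𝕜 X)}
    {g : WeakDual 𝕜 X} (hg : g ∈ derivative ε S) {V : Set (WeakDual 𝕜 X)} (hV : V ∈ 𝓝 g)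
    {U : Set X} (hU : U ∈ comap (toWeakSpace 𝕜 X) (𝓝 0)) :
    ∃ y ∈ V ∩ S, ∃ x ∈ U, ‖x‖ ≤ 1 ∧ ε / 5 < RCLike.re (y x) := by
  let A : Set (WeakDual 𝕜 X × X) :=
    {p | p.1 ∈ S ∧ ‖p.2‖ ≤ 1 ∧ ε / 2 < RCLike.re (p.1 p.2) - RCLike.re (g p.2)}
  let F : Filter (WeakDual 𝕜 X × X) := comap Prod.fst (𝓝 g) ⊓ 𝓟 A
  have hF : F.NeBot := by
    rw [inf_principal_neBot_iff]
    rintro W ⟨W', hW', hW⟩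
    obtain ⟨y, ⟨hy1, hy2⟩, hy⟩ := exists_norm_sub_gt hg hW'
    obtain ⟨x, hx1, hx2⟩ := exists_re_gt_of_lt_norm _ (by positivity) hy
    exact ⟨(y, x), hW hy1, hy2, hx1, by simpa using hx2⟩
  let 𝒰 : Ultrafilter (WeakDual 𝕜 X × X) := Ultrafilter.of F
  have hA : ∀ᶠ p in 𝒰, p ∈ A :=
    (Ultrafilter.of_le F).trans inf_le_right (mem_principal_self A)
  have hlim : Tendsto (Prod.fst : WeakDual 𝕜 X × X → _) 𝒰 (𝓝 g) :=
    tendsto_comap.mono_left ((Ultrafilter.of_le F).trans inf_le_left)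
  have hconv : ∀ f : StrongDual 𝕜 X, ∃ c : 𝕜,
      Tendsto (fun p : WeakDual 𝕜 X × X => f p.2) 𝒰 (𝓝 c) := by
    intro f
    have : ∀ᶠ p : WeakDual 𝕜 X × X in 𝒰, f p.2 ∈ Metric.closedBall (0 : 𝕜) ‖f‖ := by
      filter_upwards [hA] with p hp
      rw [mem_closedBall_zero_iff]
      exact (f.le_opNorm _).trans (mul_le_of_le_one_right (norm_nonneg _) hp.2.1)
    obtain ⟨c, -, hc⟩ := (isCompact_closedBall (0 : 𝕜) ‖f‖).ultrafilter_le_nhds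
      (𝒰.map fun p : WeakDual 𝕜 X × X => f p.2) (le_principal_iff.2 this)
    exact ⟨c, hc⟩
  let d : (WeakDual 𝕜 X × X) × (WeakDual 𝕜 X × X) → X :=
    fun q => ((1 / 2 : ℝ) : 𝕜) • (q.2.2 - q.1.2)
  have hd : ∀ f : StrongDual 𝕜 X,
      Tendsto (fun q => f (d q)) ((𝒰 : Filter _) ×ˢ (𝒰 : Filter _)) (𝓝 0) := by
    intro f
    obtain ⟨c, hc⟩ := hconv f
    have : Tendsto (fun q : (WeakDual 𝕜 X × X) × (WeakDual 𝕜 X × X) =>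
        ((1 / 2 : ℝ) : 𝕜) * (f q.2.2 - f q.1.2)) ((𝒰 : Filter _) ×ˢ (𝒰 : Filter _))
        (𝓝 (((1 / 2 : ℝ) : 𝕜) * (c - c))) :=
      ((hc.comp tendsto_snd).sub (hc.comp tendsto_fst)).const_mul _
    rw [sub_self, mul_zero] at this
    refine this.congr fun q => ?_
    simp [d]
  have hU' : ∀ᶠ q in (𝒰 : Filter _) ×ˢ (𝒰 : Filter _), d q ∈ U :=
    (tendsto_comap_iff.2 (tendsto_toWeakSpace hd)) hU
  have hg' : ∀ᶠ q in (𝒰 : Filter _) ×ˢ (𝒰 : Filter _), ‖g (d q)‖ < ε / 100 := by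
    have := (hd (WeakDual.toStrongDual g)).norm
    rw [norm_zero] at this
    exact this.eventually_lt_const (by positivity)
  obtain ⟨p', hp', hUg⟩ := (hA.and (hU'.and hg').curry).exists
  have hsmall : ∀ᶠ p : WeakDual 𝕜 X × X in 𝒰, ‖p.1 p'.2 - g p'.2‖ < ε / 20 := by
    have := (((WeakDual.eval_continuous p'.2).tendsto g).comp hlim).sub_const (g p'.2)
    rw [sub_self] at this
    have := this.norm
    rw [norm_zero] at this
    exact this.eventually_lt_const (by positivity)
  obtain ⟨p, hpV, hpA, ⟨hpU, hpg⟩, hps⟩ :=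
    ((hlim.eventually hV).and (hA.and (hUg.and hsmall))).exists
  refine ⟨p.1, ⟨hpV, hpA.1⟩, d (p', p), hpU, ?_, ?_⟩
  · have := norm_sub_le p.2 p'.2
    have h1 := hpA.2.1
    have h2 := hp'.2.1
    simp only [d]
    rw [norm_smul, RCLike.norm_ofReal, abs_of_pos (by norm_num)]
    linarith
  · have h1 := RCLike.abs_re_le_norm (g (d (p', p)))
    have h2 := RCLike.abs_re_le_norm (p.1 p'.2 - g p'.2)
    have h3 := hpA.2.2
    have h4 := (abs_le.1 h1).1
    have h5 := (abs_le.1 h2).2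
    have e1 : RCLike.re (p.1 (d (p', p))) =
        1 / 2 * (RCLike.re (p.1 p.2) - RCLike.re (p.1 p'.2)) := by
      simp only [d, map_smul, smul_eq_mul, RCLike.re_ofReal_mul, map_sub]
    have e2 : RCLike.re (g (d (p', p))) =
        1 / 2 * (RCLike.re (g p.2) - RCLike.re (g p'.2)) := by
      simp only [d, map_smul, smul_eq_mul, RCLike.re_ofReal_mul, map_sub]
    rw [map_sub] at h5
    rw [e1]
    rw [e2] at h4
    linarith

variable (𝕜 X) in
/-- The weak neighbourhoods of `0` in `X`, directed by reverse inclusion. They are taken as sets of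
vectors, not as finite sets of functionals, so that they live in the universe of `X`. -/
abbrev WeakNhd : Type u := {U : Set X // U ∈ comap (toWeakSpace 𝕜 X) (𝓝 0)}ᵒᵈ

instance : IsDirectedOrder (WeakNhd 𝕜 X) :=
  ⟨fun U V => ⟨OrderDual.toDual ⟨U.ofDual.1 ∩ V.ofDual.1, inter_mem U.ofDual.2 V.ofDual.2⟩,
    inter_subset_left, inter_subset_right⟩⟩

instance : Nonempty (WeakNhd 𝕜 X) := ⟨OrderDual.toDual ⟨univ, univ_mem⟩⟩

theorem tendsto_of_mem_weakNhd {x : WeakNhd 𝕜 X → X} (h : ∀ U : WeakNhd 𝕜 X, x U ∈ U.ofDual.1) :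
    Tendsto (fun U => toWeakSpace 𝕜 X (x U)) atTop (𝓝 0) := by
  have : Tendsto x atTop (comap (toWeakSpace 𝕜 X) (𝓝 0)) := fun W hW => by
    rw [mem_map]
    filter_upwards [eventually_ge_atTop (OrderDual.toDual ⟨W, hW⟩ : WeakNhd 𝕜 X)] with U hU
    exact hU (h U)
  exact tendsto_comap_iff.1 this

/-- The transfinite derivation of `K` whose step from `ζ` to `ζ + 1` is `s_{e ζ}` (the identity if
`e ζ ≤ 0`). -/
noncomputable def mixedDerivative (e : Ordinal.{w} → ℝ) (K : Set (WeakDual 𝕜 X))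
    (o : Ordinal.{w}) : Set (WeakDual 𝕜 X) :=
  Ordinal.limitRecOn o K (fun o S => if 0 < e o then derivative (e o) S else S)
    (fun o _ S => ⋂ (ζ) (h : ζ < o), S ζ h)

section Mixed

variable {e : Ordinal.{w} → ℝ} {K : Set (WeakDual 𝕜 X)} {a b : Ordinal.{w}}

theorem mixedDerivative_zero : mixedDerivative e K 0 = K := by
  simp [mixedDerivative]

theorem mixedDerivative_add_one :
    mixedDerivative e K (a + 1) =
      if 0 < e a then derivative (e a) (mixedDerivative e K a) else mixedDerivative e K a := by
  simp [mixedDerivative]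

theorem mixedDerivative_limit (ha : Order.IsSuccLimit a) :
    mixedDerivative e K a = ⋂ (ζ) (_ : ζ < a), mixedDerivative e K ζ := by
  rw [mixedDerivative, Ordinal.limitRecOn_limit _ _ _ _ ha]
  rfl

theorem mixedDerivative_anti (h : a ≤ b) : mixedDerivative e K b ⊆ mixedDerivative e K a := by
  induction b using Ordinal.limitRecOn with
  | zero => rw [nonpos_iff_eq_zero.1 h]
  | add_one b ih =>
    rcases h.eq_or_lt with rfl | h
    · rfl
    · rw [mixedDerivative_add_one]
      refine Subset.trans ?_ (ih (Order.lt_add_one_iff.1 h))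
      split_ifs
      · exact derivative_subset _ _
      · rfl
  | limit b hb _ =>
    rcases h.eq_or_lt with rfl | h
    · rfl
    · rw [mixedDerivative_limit hb]
      exact iInter₂_subset a h

theorem iterDerivative_subset_mixedDerivative {ε : ℝ} (he : ∀ η < b, e (a + η) = ε) :
    iterDerivative ε b (mixedDerivative e K a) ⊆ mixedDerivative e K (a + b) := by
  induction b using Ordinal.limitRecOn with
  | zero => simp
  | add_one b ih =>
    have hb : b < b + 1 := Order.lt_add_one_iff.2 le_rfl
    have ih := ih fun η hη => he η (hη.trans hb)
    rw [← add_assoc, mixedDerivative_add_one, he b hb]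
    split_ifs with h
    · rw [iterDerivative_add_one h]
      exact derivative_mono ih le_rfl
    · rw [iterDerivative_of_nonpos (not_lt.1 h)] at ih ⊢
      exact ih
  | limit b hb ih =>
    rw [mixedDerivative_limit (Ordinal.isSuccLimit_add a hb)]
    refine subset_iInter₂ fun ζ hζ => ?_
    rcases le_or_gt a ζ with h | h
    · obtain ⟨c, rfl⟩ := le_iff_exists_add.1 h
      have hc : c < b := lt_of_add_lt_add_left hζ
      exact (iterDerivative_anti _ _ hc.le).trans (ih c hc fun η hη => he η (hη.trans hc))
    · exact (iterDerivative_subset _ _ _).trans (mixedDerivative_anti h.le)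

theorem foldDerivative_subset_mixedDerivative (l : List ℝ) {β : Ordinal.{w}}
    (he : ∀ i < l.length, ∀ η < β, e (β * (i : ℕ) + η) = l.reverse.getD i 0) :
    foldDerivative β l K ⊆ mixedDerivative e K (β * (l.length : ℕ)) := by
  induction l with
  | nil => simp [mixedDerivative_zero]
  | cons ε l ih =>
    rw [List.length_cons, Nat.cast_add, Nat.cast_one, mul_add, mul_one]
    refine Subset.trans (iterDerivative_mono (ih fun i hi η hη => ?_) le_rfl _)
      (iterDerivative_subset_mixedDerivative fun η hη => ?_)
    · rw [he i (by simp; omega) η hη, List.reverse_cons, List.getD_append _ _ _ _ (by simpa)]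
    · rw [he _ (by simp) η hη, List.reverse_cons, List.getD_append_right _ _ _ _ (by simp)]
      simp

end Mixed

/-- A tree indexed by the strictly decreasing sequences below `top`, each node of which moves from
`L ζ'` to `L ζ` for some `ζ < ζ'`. A node carries, besides `g t` and `x t`, a weak* open set
containing `g t` in which all inequalities obtained so far persist. -/
theorem exists_tree {L : Ordinal.{w} → Set (WeakDual 𝕜 X)} {c : Ordinal.{w} → ℝ}
    {top : Ordinal.{w}} {g₀ : WeakDual 𝕜 X} (hg₀ : g₀ ∈ L top)
    (hstep : ∀ ζ ζ', ζ < ζ' → ∀ f ∈ L ζ', ∀ V ∈ 𝓝 f, ∀ U : WeakNhd 𝕜 X,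
      ∃ y ∈ V ∩ L ζ, ∃ x ∈ U.ofDual.1, ‖x‖ ≤ 1 ∧ c ζ < RCLike.re (y x)) :
    ∃ (g : List (Ordinal.{w} × WeakNhd 𝕜 X) → WeakDual 𝕜 X)
      (x : List (Ordinal.{w} × WeakNhd 𝕜 X) → X),
      ∀ t, (top :: t.map Prod.fst).Pairwise (· > ·) →
        g t ∈ L ((t.map Prod.fst).getLastD top) ∧
        (∀ s a, s ++ [a] <+: t → c a.1 < RCLike.re (g t (x (s ++ [a])))) ∧
        (∀ s a, t = s ++ [a] → ‖x t‖ ≤ 1 ∧ x t ∈ a.2.ofDual.1) := by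
  classical
  let good (σ : WeakDual 𝕜 X × Set (WeakDual 𝕜 X) × X) (a : Ordinal.{w} × WeakNhd 𝕜 X)
      (p : WeakDual 𝕜 X × X) : Prop :=
    p.1 ∈ σ.2.1 ∩ L a.1 ∧ p.2 ∈ a.2.ofDual.1 ∧ ‖p.2‖ ≤ 1 ∧ c a.1 < RCLike.re (p.1 p.2)
  let next (σ : WeakDual 𝕜 X × Set (WeakDual 𝕜 X) × X) (a : Ordinal.{w} × WeakNhd 𝕜 X) :
      WeakDual 𝕜 X × Set (WeakDual 𝕜 X) × X :=
    if h : ∃ p, good σ a p then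
      (h.choose.1, σ.2.1 ∩ {f | c a.1 < RCLike.re (f h.choose.2)}, h.choose.2) else σ
  let st (t : List (Ordinal.{w} × WeakNhd 𝕜 X)) := t.foldl next (g₀, univ, 0)
  refine ⟨fun t => (st t).1, fun t => (st t).2.2, fun t => ?_⟩
  suffices H : (top :: t.map Prod.fst).Pairwise (· > ·) →
      IsOpen (st t).2.1 ∧ (st t).1 ∈ (st t).2.1 ∧ (st t).1 ∈ L ((t.map Prod.fst).getLastD top) ∧
      (∀ s a, s ++ [a] <+: t → ∀ f ∈ (st t).2.1, c a.1 < RCLike.re (f (st (s ++ [a])).2.2)) ∧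
      (∀ s a, t = s ++ [a] → ‖(st t).2.2‖ ≤ 1 ∧ (st t).2.2 ∈ a.2.ofDual.1) by
    intro ht
    obtain ⟨-, h2, h3, h4, h5⟩ := H ht
    exact ⟨h3, fun s a hs => h4 s a hs _ h2, h5⟩
  induction t using List.reverseRecOn with
  | nil => exact fun _ => ⟨isOpen_univ, mem_univ _, hg₀, by simp, by simp⟩
  | append_singleton t a ih =>
    intro ht
    rw [List.map_append, ← List.cons_append, List.pairwise_append] at ht
    obtain ⟨h1, h2, h3, h4, h5⟩ := ih ht.1
    have hlt : a.1 < (t.map Prod.fst).getLastD top := by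
      refine ht.2.2 _ ?_ a.1 (by simp)
      rcases List.eq_nil_or_concat (t.map Prod.fst) with h | ⟨l, b, h⟩
      · simp [h]
      · rw [h, List.concat_eq_append, List.getLastD_concat]
        simp
    obtain ⟨y, hy, x, hx1, hx2, hx3⟩ := hstep _ _ hlt _ h3 _ (h1.mem_nhds h2) a.2
    have hex : ∃ p, good (st t) a p := ⟨(y, x), hy, hx1, hx2, hx3⟩
    obtain ⟨k1, k2, k3, k4⟩ := hex.choose_spec
    have hst : st (t ++ [a]) = (hex.choose.1,
        (st t).2.1 ∩ {f | c a.1 < RCLike.re (f hex.choose.2)}, hex.choose.2) := by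
      simp only [st, List.foldl_append, List.foldl_cons, List.foldl_nil]
      exact dif_pos hex
    refine ⟨?_, ?_, ?_, ?_, ?_⟩
    · rw [hst]
      exact h1.inter (isOpen_lt continuous_const
        (RCLike.continuous_re.comp (WeakDual.eval_continuous _)))
    · rw [hst]
      exact ⟨k1.1, k4⟩
    · rw [hst, List.map_append]
      simpa using k1.2
    · intro s b hs f hf
      rw [hst] at hf
      rcases List.prefix_concat_iff.1 hs with h | h
      · rw [h, hst]
        obtain ⟨-, h⟩ := List.append_inj' h rfl
        obtain rfl : b = a := by simpa using h
        exact hf.2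
      · exact h4 s b h f hf.1
    · intro s b hs
      obtain ⟨-, h⟩ := List.append_inj' hs rfl
      obtain rfl : a = b := by simpa using h
      rw [hst]
      exact ⟨k3, k2⟩

theorem Gamma_lt {n : ℕ} {s : List Ordinal.{w}} (hs : s ∈ Gamma ξ n) :
    ∀ a ∈ s, a < Ordinal.omega0 ^ ξ * n := by
  obtain ⟨L, t, h⟩ := (mem_Gamma_iff _ _ _).1 hs
  rw [h.2.2.2]
  exact assemble_lt n _ fun r hr => (h.bound r hr).2

theorem pairwise_shift {t : List Ordinal.{w}} (h : t.Pairwise (· > ·)) :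
    (shift ζ t).Pairwise (· > ·) :=
  h.map _ fun _ _ hab => add_lt_add_right hab ζ

theorem Gamma_pairwise_of (H : ∀ t ∈ Gamma₁ ξ, t.Pairwise (· > ·)) {n : ℕ}
    {s : List Ordinal.{w}} (hs : s ∈ Gamma ξ n) : s.Pairwise (· > ·) := by
  induction n generalizing s with
  | zero => simp [Gamma_zero] at hs
  | succ n ih =>
    rcases mem_Gamma_succ.1 hs with ⟨t, ht, rfl⟩ | ⟨r, hr, s', hs', rfl⟩
    · exact pairwise_shift (H t ht)
    · refine List.pairwise_append.2 ⟨pairwise_shift (H r hr.1), ih hs', fun a ha b hb => ?_⟩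
      simp only [shift, List.mem_map] at ha
      obtain ⟨a, -, rfl⟩ := ha
      exact (Gamma_lt hs' b hb).trans_le le_self_add

theorem Gamma₁_pairwise : ∀ t ∈ Gamma₁ ξ, t.Pairwise (· > ·) := by
  induction ξ using Ordinal.limitRecOn with
  | zero => simp [Gamma₁_zero]
  | add_one ξ ih =>
    intro t ht
    obtain ⟨n, -, h⟩ := mem_Gamma₁_succ.1 ht
    exact Gamma_pairwise_of ih h
  | limit ξ hξ ih =>
    intro t ht
    obtain ⟨ζ, hζ, s, hs, rfl⟩ := (mem_Gamma₁_limit hξ).1 ht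
    exact pairwise_shift (ih _ (hξ.add_one_lt hζ) s hs)

/-- Members of `Γ_{ξ,n}` are strictly decreasing sequences in `[0, ω ^ ξ * n)`. -/
theorem Gamma_pairwise {n : ℕ} {s : List Ordinal.{w}} (hs : s ∈ Gamma ξ n) :
    (Ordinal.omega0 ^ ξ * n :: s).Pairwise (· > ·) :=
  List.pairwise_cons.2 ⟨Gamma_lt hs, Gamma_pairwise_of Gamma₁_pairwise hs⟩

/-- The level of a node of `Γ_{ξ,n}` is determined by its last entry. -/
theorem Lambda_last {n i : ℕ} {s : List Ordinal.{w}} (hs : s ∈ Lambda ξ n (i + 1)) :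
    ∃ s' η, s = s' ++ [Ordinal.omega0 ^ ξ * (n - (i + 1) : ℕ) + η] ∧ η < Ordinal.omega0 ^ ξ := by
  induction n generalizing i s with
  | zero =>
    obtain ⟨L, t, h, -⟩ := hs
    exact absurd h.1 (by omega)
  | succ n ih =>
    cases i with
    | zero =>
      obtain ⟨t, ht, rfl⟩ := mem_Lambda_one.1 hs
      obtain ⟨h0, hb⟩ := Gamma₁_bound ξ t ht
      obtain ⟨t, η, rfl⟩ := (List.eq_nil_or_concat t).resolve_left h0
      exact ⟨shift (Ordinal.omega0 ^ ξ * n) t, η, by simp [shift], hb η (by simp)⟩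
    | succ i =>
      obtain ⟨r, -, s, hs', rfl⟩ := mem_Lambda_succ.1 hs
      obtain ⟨s, η, rfl, hη⟩ := ih hs'
      exact ⟨_, η, by rw [Nat.add_sub_add_right, List.append_assoc], hη⟩

theorem bddAbove_re_image {K : Set (WeakDual 𝕜 X)} (hK : IsCompact K) (x : X) :
    BddAbove ((fun f : WeakDual 𝕜 X => RCLike.re (f x)) '' K) :=
  (hK.image (RCLike.continuous_re.comp (WeakDual.eval_continuous x))).bddAbove

/-- If `s^{ω^ξ}_{ε_1} ⋯ s^{ω^ξ}_{ε_n}(K)` is non-empty, then some weakly null tree on `Γ_{ξ,n}`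
has, along each of its branches, a functional in `K` that is about `ε_i / 5` on the `i`-th level. -/
theorem exists_weaklyNull_of_foldDerivative_nonempty {K : Set (WeakDual 𝕜 X)} (hK : IsCompact K)
    {n : ℕ} {ε : Fin n → ℝ}
    (hne : (foldDerivative (Ordinal.omega0 ^ ξ) (List.ofFn ε) K).Nonempty) {δ : ℝ} (hδ : 0 < δ) :
    ∃ x : List (Ordinal.{w} × WeakNhd 𝕜 X) → X,
      (∀ t ∈ dTree (Gamma ξ n) (WeakNhd 𝕜 X), ‖x t‖ ≤ 1) ∧ IsWeaklyNull 𝕜 (Gamma ξ n) x ∧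
      ∀ a : Fin n → ℝ, (∀ i, 0 ≤ a i) → ∀ t ∈ dTree (branches ξ n) (WeakNhd 𝕜 X), n ≠ 0 →
        ∑ i, a i * (ε i / 5 - δ) ≤
          supportFun K (∑ i : Fin n, (a i : 𝕜) • levelSum 𝕜 ξ n (i + 1) x t) := by
  set β := Ordinal.omega0 ^ ξ with hβ
  have hβ0 : β ≠ 0 := (Ordinal.opow_pos _ Ordinal.omega0_pos).ne'
  let e : Ordinal.{w} → ℝ := fun ζ =>
    (List.ofFn ε).reverse.getD (Cardinal.toNat (ζ / β).card) 0
  have he : ∀ m : ℕ, ∀ η < β, e (β * m + η) = (List.ofFn ε).reverse.getD m 0 := by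
    intro m η hη
    simp only [e]
    rw [Ordinal.mul_add_div _ hβ0, Ordinal.div_eq_zero_of_lt hη]
    simp
  have he' : ∀ i : Fin n, ∀ η < β, e (β * (n - (i + 1) : ℕ) + η) = ε i := by
    intro i η hη
    have hi := i.2
    rw [he _ _ hη, List.getD_eq_getElem _ _ (by simp; omega), List.getElem_reverse,
      List.getElem_ofFn]
    congr 1
    ext
    simp
    omega
  obtain ⟨g₀, hg₀⟩ := hne
  have hg₀ := foldDerivative_subset_mixedDerivative _ (fun i _ η hη => he i η hη) hg₀
  rw [List.length_ofFn] at hg₀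
  obtain ⟨g, x, H⟩ := exists_tree (L := mixedDerivative e K) (c := fun ζ => e ζ / 5 - δ)
    hg₀ (by
      intro ζ ζ' hζ f hf V hV U
      have hf := mixedDerivative_anti (Order.add_one_le_iff.2 hζ) hf
      rw [mixedDerivative_add_one] at hf
      split_ifs at hf with h
      · obtain ⟨y, hy, x, hxU, hx1, hx⟩ := exists_large_of_mem_derivative h hf hV U.ofDual.2
        exact ⟨y, hy, x, hxU, hx1, by linarith⟩
      · refine ⟨f, ⟨mem_of_mem_nhds hV, hf⟩, 0, ?_, by simp, ?_⟩
        · obtain ⟨W, hW, hWU⟩ := U.ofDual.2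
          have h0 : (0 : WeakSpace 𝕜 X) ∈ W := mem_of_mem_nhds hW
          exact hWU (show toWeakSpace 𝕜 X 0 ∈ W by rwa [map_zero])
        · rw [map_zero, map_zero]
          linarith)
  have hdec : ∀ t ∈ dTree (Gamma ξ n) (WeakNhd 𝕜 X),
      (β * n :: t.map Prod.fst).Pairwise (· > ·) := fun t ht => Gamma_pairwise ht
  refine ⟨x, fun t ht => ?_, fun t ζ ht => ?_, fun a ha t ht hn => ?_⟩
  · obtain ⟨s, b, hs⟩ := (List.eq_nil_or_concat t).resolve_left fun h =>
      ne_nil_of_mem_Gamma ht (by simp [h])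
    rw [List.concat_eq_append] at hs
    exact ((H t (hdec t ht)).2.2 s b hs).1
  · refine tendsto_of_mem_weakNhd fun U => ?_
    exact ((H _ (hdec (t ++ [(ζ, U)]) (by simpa [dTree] using ht))).2.2 t (ζ, U) rfl).2
  · have htG : t ∈ dTree (Gamma ξ n) (WeakNhd 𝕜 X) := by
      rw [← maxNodes_Gamma_eq (Nat.one_le_iff_ne_zero.2 hn)] at ht
      exact ht.1
    obtain ⟨h1, h2, -⟩ := H t (hdec t htG)
    have hgK : g t ∈ K := by
      have := mixedDerivative_anti (a := 0) zero_le h1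
      rwa [mixedDerivative_zero] at this
    refine le_trans ?_ (le_csSup (bddAbove_re_image hK _) (mem_image_of_mem _ hgK))
    simp only [map_sum, map_smul, smul_eq_mul, RCLike.re_ofReal_mul]
    refine Finset.sum_le_sum fun i _ => mul_le_mul_of_nonneg_left ?_ (ha i)
    rw [levelSum_eq_weightedSum]
    refine le_re_weightedSum (fun s hs => prob_nonneg (Lambda_subset_Gamma i.2 hs))
      (weightedSum_Lambda_one ht i.2) _ fun s hs hst => ?_
    obtain ⟨s', η, hs', hη⟩ := Lambda_last (show s.map Prod.fst ∈ Lambda ξ n (i + 1) from hs)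
    obtain ⟨s, b, rfl⟩ := (List.eq_nil_or_concat s).resolve_left (by
      rintro rfl
      simp at hs')
    rw [List.concat_eq_append] at hs' hst ⊢
    have hb : b.1 = β * (n - (i + 1) : ℕ) + η := by
      rw [List.map_append] at hs'
      simpa using (List.append_inj' hs' rfl).2
    have := h2 s b hst
    simp only [hb, he' i η hη] at this
    exact this.le

end Ascent

/-! ### Conjugate exponents and `ℓ_p` norms -/

section Exponents

theorem conj_cases {p : ℝ≥0∞} {q : ℝ} (hq : 1 ≤ q) (h : 1 / p + 1 / ENNReal.ofReal q = 1) :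
    (q = 1 ∧ p = ⊤) ∨ (p ≠ ⊤ ∧ p.toReal.HolderConjugate q) := by
  have hq0 : 0 < q := by linarith
  have hp0 : p ≠ 0 := by
    rintro rfl
    simp at h
  rcases hq.eq_or_lt with rfl | hq1
  · left
    refine ⟨rfl, ?_⟩
    simp only [one_div, ENNReal.ofReal_one, inv_one] at h
    have : p⁻¹ = 0 := by
      by_contra hne
      have : (1 : ℝ≥0∞) < p⁻¹ + 1 := by
        rw [add_comm]
        exact ENNReal.lt_add_right (by simp) hne
      exact this.ne' h
    simpa using this
  · right
    have hpt : p ≠ ⊤ := by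
      rintro rfl
      simp only [one_div, ENNReal.inv_top, zero_add, ENNReal.inv_eq_one] at h
      rw [ENNReal.ofReal_eq_one] at h
      exact hq1.ne' h
    refine ⟨hpt, (Real.holderConjugate_iff_eq_conjExponent ?_).2 ?_ |>.symm⟩
    · exact hq1
    · have h' := congrArg ENNReal.toReal h
      rw [ENNReal.toReal_add (by simp [hp0]) (by simp [hq0])] at h'
      simp only [one_div, ENNReal.toReal_inv, ENNReal.toReal_ofReal hq0.le, ENNReal.toReal_one]
        at h'
      have hpr : 0 < p.toReal := ENNReal.toReal_pos hp0 hpt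
      have : q - 1 ≠ 0 := by linarith
      field_simp at h' ⊢
      linarith

theorem one_le_of_conj {p q : ℝ≥0∞} (h : 1 / p + 1 / q = 1) : 1 ≤ p := by
  have : p⁻¹ ≤ 1 := by
    calc p⁻¹ = 1 / p := (one_div p).symm
      _ ≤ 1 / p + 1 / q := le_self_add
      _ = 1 := h
  exact ENNReal.inv_le_one.1 this

theorem exists_conj {r : ℝ≥0∞} (hr : 1 < r) :
    ∃ r' : ℝ, 1 ≤ r' ∧ 1 / r + 1 / ENNReal.ofReal r' = 1 := by
  have h1 : r⁻¹ < 1 := ENNReal.inv_lt_one.2 hr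
  have h2 : (1 - r⁻¹)⁻¹ ≠ ⊤ := ENNReal.inv_ne_top.2 (tsub_pos_of_lt h1).ne'
  refine ⟨(1 - r⁻¹)⁻¹.toReal, ?_, ?_⟩
  · rw [← ENNReal.toReal_one]
    exact ENNReal.toReal_mono h2 (ENNReal.one_le_inv.2 tsub_le_self)
  · rw [ENNReal.ofReal_toReal h2, one_div, one_div, inv_inv, add_tsub_cancel_of_le h1.le]

theorem conj_lt_iff {p q r s : ℝ≥0∞} (hpq : 1 / p + 1 / q = 1) (hrs : 1 / r + 1 / s = 1) :
    p < r ↔ s < q := by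
  have key : ∀ {p q r s : ℝ≥0∞}, 1 / p + 1 / q = 1 → 1 / r + 1 / s = 1 → p < r → s < q := by
    intro p q r s hpq hrs h
    have h1 : r⁻¹ < p⁻¹ := ENNReal.inv_lt_inv.2 h
    simp only [one_div] at hpq hrs
    rw [← ENNReal.inv_lt_inv]
    by_contra! hle
    have hq : s⁻¹ ≠ ⊤ := fun h => by simp [h] at hrs
    have : r⁻¹ + s⁻¹ < p⁻¹ + q⁻¹ := ENNReal.add_lt_add_of_lt_of_le hq h1 hle
    rw [hpq, hrs] at this
    exact lt_irrefl _ this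
  exact ⟨key hpq hrs, fun h => key (by rwa [add_comm]) (by rwa [add_comm]) h⟩

variable {𝕜 : Type v} [RCLike 𝕜] {n : ℕ}

theorem sum_norm_mul_le {p : ℝ≥0∞} {q : ℝ} (hq : 1 ≤ q) (h : 1 / p + 1 / ENNReal.ofReal q = 1)
    (a : Fin n → 𝕜) {ε : Fin n → ℝ} (hε : ∀ i, 0 ≤ ε i) :
    ∑ i, ‖a i‖ * ε i ≤
      ‖(WithLp.toLp p a : PiLp p fun _ : Fin n => 𝕜)‖ * (∑ i, ε i ^ q) ^ (1 / q) := by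
  rcases conj_cases hq h with ⟨rfl, rfl⟩ | ⟨hp, hc⟩
  · rw [PiLp.norm_eq_ciSup]
    simp only [Real.rpow_one, div_one]
    rw [Finset.mul_sum]
    exact Finset.sum_le_sum fun i _ => mul_le_mul_of_nonneg_right
      (le_ciSup (f := fun i => ‖a i‖) (finite_range _).bddAbove i) (hε i)
  · rw [PiLp.norm_eq_sum hc.pos]
    have := Real.inner_le_Lp_mul_Lq Finset.univ (fun i => ‖a i‖) ε hc
    simpa only [abs_norm, abs_of_nonneg (hε _)] using this

/-- A non-negative functional on `ℓ_p^n` bounded by `c` has `ℓ_q^n` norm at most `c`. -/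
theorem sum_rpow_le_of_forall {p : ℝ≥0∞} {q c : ℝ} (hq : 1 ≤ q) (hn : n ≠ 0) (hc : 0 ≤ c)
    (h : 1 / p + 1 / ENNReal.ofReal q = 1) {ε : Fin n → ℝ} (hε : ∀ i, 0 ≤ ε i)
    (H : ∀ a : Fin n → ℝ, (∀ i, 0 ≤ a i) → ∑ i, a i * ε i ≤
      c * ‖(WithLp.toLp p fun i => (a i : 𝕜) : PiLp p fun _ : Fin n => 𝕜)‖) :
    ∑ i, ε i ^ q ≤ c ^ q := by
  rcases conj_cases hq h with ⟨rfl, rfl⟩ | ⟨hp, hpq⟩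
  · have : Nonempty (Fin n) := ⟨⟨0, Nat.pos_of_ne_zero hn⟩⟩
    have := H (fun _ => 1) (fun _ => zero_le_one)
    rw [PiLp.norm_eq_ciSup] at this
    simpa using this
  · have hq0 : 0 < q := by linarith
    set A := ∑ i, ε i ^ q with hA
    have hA0 : 0 ≤ A := Finset.sum_nonneg fun i _ => Real.rpow_nonneg (hε i) q
    -- the extremal coefficients are `ε_i ^ (q - 1)`
    have h1 := H (fun i => ε i ^ (q - 1)) (fun i => Real.rpow_nonneg (hε i) _)
    rw [PiLp.norm_eq_sum hpq.pos] at h1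
    have e1 : ∀ i, ε i ^ (q - 1) * ε i = ε i ^ q := by
      intro i
      rcases (hε i).eq_or_lt with h0 | h0
      · rw [← h0, Real.zero_rpow hq0.ne', mul_zero]
      · rw [← Real.rpow_add_one h0.ne', sub_add_cancel]
    have e2 : ∀ i, ‖((ε i ^ (q - 1) : ℝ) : 𝕜)‖ ^ p.toReal = ε i ^ q := by
      intro i
      rw [RCLike.norm_ofReal, abs_of_nonneg (Real.rpow_nonneg (hε i) _), ← Real.rpow_mul (hε i),
        hpq.symm.sub_one_mul_conj]
    simp only [e1, e2] at h1
    rw [← hA] at h1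
    rcases hA0.eq_or_lt with h0 | h0
    · rw [← h0]
      exact Real.rpow_nonneg hc q
    · have e3 : A = A ^ (1 / q) * A ^ (1 / p.toReal) := by
        have := hpq.inv_add_inv_eq_one
        rw [← Real.rpow_add h0, one_div, one_div, add_comm, this, Real.rpow_one]
      have h2 : A ^ (1 / q) ≤ c := by
        rw [e3] at h1
        have hpos : 0 < A ^ (1 / p.toReal) := Real.rpow_pos_of_pos h0 _
        rw [← e3] at h1
        refine le_of_mul_le_mul_right ?_ hpos
        rwa [← e3]
      calc A = (A ^ (1 / q)) ^ q := by
            rw [← Real.rpow_mul hA0, one_div, inv_mul_cancel₀ hq0.ne', Real.rpow_one]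
        _ ≤ c ^ q := Real.rpow_le_rpow (Real.rpow_nonneg hA0 _) h2 hq0.le

end Exponents

/-! ### Bounds for `α_{ξ,p}` and summability -/

section Alpha

variable {𝕜 : Type v} [RCLike 𝕜] {X : Type u} [NormedAddCommGroup X] [NormedSpace 𝕜 X]
  {ξ : Ordinal.{w}} {K : Set (WeakDual 𝕜 X)} {p : ℝ≥0∞}

/-- `α` is one of the numbers whose infimum is `α_{ξ,p,n}(K)`. -/
def IsAlphaBound (ξ : Ordinal.{w}) (p : ℝ≥0∞) (n : ℕ) (K : Set (WeakDual 𝕜 X)) (α : ℝ) : Prop :=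
  ∀ (D : Type u) [Preorder D] [IsDirectedOrder D] [Nonempty D] (a : Fin n → 𝕜)
    (x : List (Ordinal.{w} × D) → X),
    (∀ t ∈ dTree (Gamma ξ n) D, ‖x t‖ ≤ 1) →
    IsWeaklyNull 𝕜 (Gamma ξ n) x →
    ⨅ t : maxNodes (dTree (Gamma ξ n) D),
        supportFun K (∑ i : Fin n, a i • levelSum 𝕜 ξ n (i + 1) x t) ≤
      α * ‖(WithLp.toLp p a : PiLp p fun _ : Fin n => 𝕜)‖

theorem alpha_lt_top_iff (hp : 1 ≤ p) :
    alpha ξ p K < ⊤ ↔ ∃ α : ℝ, 0 < α ∧ ∀ n : ℕ, 1 ≤ n → IsAlphaBound ξ p n K α := by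
  constructor
  · intro h
    have hpos : 0 < (alpha ξ p K).toReal + 1 := by positivity
    refine ⟨(alpha ξ p K).toReal + 1, hpos, fun n hn => ?_⟩
    have h1 : alphaN ξ p n K < ENNReal.ofReal ((alpha ξ p K).toReal + 1) := by
      refine (le_iSup₂ (f := fun n (_ : n ∈ Ici (1 : ℕ)) => alphaN ξ p n K) n hn).trans_lt ?_
      change alpha ξ p K < _
      rw [ENNReal.lt_ofReal_iff_toReal_lt h.ne]
      exact lt_add_one _
    obtain ⟨A, ⟨α, hα, rfl, H⟩, hlt⟩ := sInf_lt_iff.1 h1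
    intro D _ _ _ a x hx hnull
    have : Fact (1 ≤ p) := ⟨hp⟩
    exact (H D a x hx hnull).trans (mul_le_mul_of_nonneg_right
      ((ENNReal.ofReal_lt_ofReal_iff hpos).1 hlt).le (norm_nonneg _))
  · rintro ⟨α, hα, H⟩
    refine lt_of_le_of_lt (b := ENNReal.ofReal α) ?_ ENNReal.ofReal_lt_top
    exact iSup₂_le fun n hn => sInf_le ⟨α, hα, rfl, fun D _ _ _ a x hx hnull =>
      H n hn D a x hx hnull⟩

theorem exists_norm_bound [CompleteSpace X] (hK : IsCompact K) :
    ∃ R : ℝ, 0 ≤ R ∧ ∀ f ∈ K, ∀ x, ‖f x‖ ≤ R * ‖x‖ := by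
  obtain ⟨C, hC⟩ := banach_steinhaus (g := fun f : K => WeakDual.toStrongDual f.1) (by
    intro x
    obtain ⟨C, hC⟩ := (hK.image (WeakDual.eval_continuous x).norm).bddAbove
    exact ⟨C, fun f => hC (mem_image_of_mem _ f.2)⟩)
  refine ⟨max C 0, le_max_right _ _, fun f hf x => ?_⟩
  exact (ContinuousLinearMap.le_of_opNorm_le _ (hC ⟨f, hf⟩) x).trans
    (mul_le_mul_of_nonneg_right (le_max_left _ _) (norm_nonneg _))

theorem foldDerivative_map_max (o : Ordinal.{w}) (l : List ℝ) (S : Set (WeakDual 𝕜 X)) :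
    foldDerivative o (l.map (max · 0)) S = foldDerivative o l S := by
  induction l with
  | nil => rfl
  | cons ε l ih =>
    simp only [foldDerivative, List.map_cons, List.foldr_cons] at ih ⊢
    rw [ih]
    rcases le_total ε 0 with h | h
    · rw [max_eq_right h, iterDerivative_of_nonpos h, iterDerivative_of_nonpos le_rfl]
    · rw [max_eq_left h]

/-- The infimum in the definition of `α_{ξ,p,n}(K)` is at most `∑ |a_i| ε_i`, up to an arbitrarily
small error, for some bounded `ε_i ≥ 0` with `s^{ω^ξ}_{ε_1} ⋯ s^{ω^ξ}_{ε_n}(K) ≠ ∅`. -/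
theorem exists_iInf_supportFun_le [CompleteSpace X] (hK : IsCompact K) (ξ : Ordinal.{w}) {δ : ℝ}
    (hδ : 0 < δ) :
    ∃ B : ℝ, 0 ≤ B ∧ ∀ n : ℕ, 1 ≤ n → ∀ (D : Type u) [Preorder D] [IsDirectedOrder D] [Nonempty D]
      (a : Fin n → 𝕜) (x : List (Ordinal.{w} × D) → X),
      (∀ t ∈ dTree (Gamma ξ n) D, ‖x t‖ ≤ 1) → IsWeaklyNull 𝕜 (Gamma ξ n) x →
      0 < (⨅ t : maxNodes (dTree (Gamma ξ n) D),
        supportFun K (∑ i : Fin n, a i • levelSum 𝕜 ξ n (i + 1) x t)) →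
      ∃ ε : Fin n → ℝ, (∀ i, 0 ≤ ε i ∧ ε i ≤ B) ∧
        (foldDerivative (Ordinal.omega0 ^ ξ) (List.ofFn ε) K).Nonempty ∧
        (⨅ t : maxNodes (dTree (Gamma ξ n) D),
          supportFun K (∑ i : Fin n, a i • levelSum 𝕜 ξ n (i + 1) x t)) ≤
            ∑ i, ‖a i‖ * (ε i + 2 * δ) := by
  obtain ⟨R, hR0, hR⟩ := exists_norm_bound hK
  obtain ⟨N, hN⟩ := exists_nat_ge ((R + 2 * δ) / δ)
  rw [div_le_iff₀ hδ] at hN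
  refine ⟨N * δ, by positivity, fun n hn D _ _ _ a x hx hnull hpos => ?_⟩
  set m := ⨅ t : maxNodes (dTree (Gamma ξ n) D),
    supportFun K (∑ i : Fin n, a i • levelSum 𝕜 ξ n (i + 1) x t) with hm
  -- a real infimum that is not bounded below would be `0`
  have hbdd : BddBelow (range fun t : maxNodes (dTree (Gamma ξ n) D) =>
      supportFun K (∑ i : Fin n, a i • levelSum 𝕜 ξ n (i + 1) x t)) := by
    by_contra h
    rw [hm, Real.iInf_of_not_bddBelow h] at hpos
    exact lt_irrefl _ hpos
  have hle : ∀ t ∈ dTree (branches ξ n) D,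
      m ≤ supportFun K (∑ i : Fin n, a i • levelSum 𝕜 ξ n (i + 1) x t) := by
    intro t ht
    rw [← maxNodes_Gamma_eq hn, ← maxNodes_dTree] at ht
    exact ciInf_le hbdd ⟨t, ht⟩
  obtain ⟨-, k, hk, hne⟩ := (levelProperty ξ).foldDerivative_nonempty hR0 hδ hN n x Unit
    (fun _ => K) (fun _ => m) a hx hnull (fun _ => hK) (fun _ => hR) (fun t ht => by
      have h1 := hle t ht
      have hKne : K.Nonempty := by
        by_contra h
        rw [not_nonempty_iff_eq_empty] at h
        rw [supportFun, h, image_empty, Real.sSup_empty] at h1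
        linarith
      obtain ⟨g, hg, e⟩ := (hK.image (RCLike.continuous_re.comp
        (WeakDual.eval_continuous (∑ i : Fin n, a i • levelSum 𝕜 ξ n (i + 1) x t)))).sSup_mem
          (hKne.image _)
      refine ⟨(), g, hg, h1.trans (e.symm.trans_le ?_)⟩
      simp only [Function.comp, map_sum]
      rfl)
  refine ⟨fun i => max (((k i : ℤ) : ℝ) * δ) 0, fun i => ⟨le_max_right _ _, max_le ?_ ?_⟩, ?_, ?_⟩
  · have : ((k i : ℤ) : ℝ) ≤ N := by exact_mod_cast (k i).2.2
    exact mul_le_mul_of_nonneg_right this hδ.le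
  · positivity
  · have e : (List.ofFn fun i => max (((k i : ℤ) : ℝ) * δ) 0) =
        (List.ofFn fun i => ((k i : ℤ) : ℝ) * δ).map (max · 0) := by
      rw [List.map_ofFn]
      rfl
    rwa [e, foldDerivative_map_max]
  · refine hk.trans (Finset.sum_le_sum fun i _ => mul_le_mul_of_nonneg_left ?_ (norm_nonneg _))
    have := le_max_left (((k i : ℤ) : ℝ) * δ) 0
    linarith

theorem alpha_one_lt_top [CompleteSpace X] (hK : IsCompact K) : alpha ξ 1 K < ⊤ := by
  obtain ⟨B, hB, H⟩ := exists_iInf_supportFun_le hK ξ one_pos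
  refine (alpha_lt_top_iff le_rfl).2 ⟨B + 2, by positivity, fun n hn D _ _ _ a x hx hnull => ?_⟩
  rcases le_or_gt (⨅ t : maxNodes (dTree (Gamma ξ n) D),
    supportFun K (∑ i : Fin n, a i • levelSum 𝕜 ξ n (i + 1) x t)) 0 with h | h
  · exact h.trans (by positivity)
  · obtain ⟨ε, hε, -, hle⟩ := H n hn D a x hx hnull h
    refine hle.trans ?_
    rw [PiLp.norm_eq_of_L1, Finset.mul_sum]
    refine Finset.sum_le_sum fun i _ => ?_
    rw [mul_comm (B + 2)]
    refine mul_le_mul_of_nonneg_left ?_ (norm_nonneg _)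
    linarith [(hε i).2]

theorem alpha_lt_top_of_hasSummableIndex [CompleteSpace X] (hK : IsCompact K) {q : ℝ} (hq : 1 ≤ q)
    (hpq : 1 / p + 1 / ENNReal.ofReal q = 1) (h : HasSummableIndex ξ q K) : alpha ξ p K < ⊤ := by
  obtain ⟨M, hM, h⟩ := h
  have hp := one_le_of_conj hpq
  have : Fact (1 ≤ p) := ⟨hp⟩
  have hq0 : 0 < q := by linarith
  refine (alpha_lt_top_iff hp).2 ⟨M + 1, by positivity, fun n hn D _ _ _ a x hx hnull => ?_⟩
  rcases le_or_gt (⨅ t : maxNodes (dTree (Gamma ξ n) D),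
    supportFun K (∑ i : Fin n, a i • levelSum 𝕜 ξ n (i + 1) x t)) 0 with h0 | h0
  · exact h0.trans (by positivity)
  refine le_trans ?_ (mul_le_mul_of_nonneg_right (le_add_of_nonneg_right zero_le_one)
    (norm_nonneg _))
  refine le_of_forall_pos_le_add fun η hη => ?_
  set s := ∑ i, ‖a i‖ with hs
  have hs0 : 0 ≤ s := Finset.sum_nonneg fun i _ => norm_nonneg _
  obtain ⟨B, -, H⟩ := exists_iInf_supportFun_le hK ξ (δ := η / (2 * (s + 1))) (by positivity)
  obtain ⟨ε, hε, hne, hle⟩ := H n hn D a x hx hnull h0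
  have h1 : ∑ i, ε i ^ q ≤ M ^ q := by
    have := h (List.ofFn ε) (by
      intro e he
      obtain ⟨i, rfl⟩ := List.mem_ofFn.1 he
      exact (hε i).1) hne
    rwa [List.map_ofFn, List.sum_ofFn] at this
  have h2 : (∑ i, ε i ^ q) ^ (1 / q) ≤ M := by
    calc (∑ i, ε i ^ q) ^ (1 / q) ≤ (M ^ q) ^ (1 / q) := Real.rpow_le_rpow
          (Finset.sum_nonneg fun i _ => Real.rpow_nonneg (hε i).1 q) h1 (by positivity)
      _ = M := by rw [← Real.rpow_mul hM, mul_one_div, div_self hq0.ne', Real.rpow_one]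
  have e : ∀ c : ℝ, ∑ i, ‖a i‖ * (ε i + c) = ∑ i, ‖a i‖ * ε i + s * c := fun c => by
    simp only [mul_add, Finset.sum_add_distrib, ← Finset.sum_mul, hs]
  rw [e] at hle
  refine hle.trans ?_
  refine add_le_add ((sum_norm_mul_le hq hpq a fun i => (hε i).1).trans ?_) ?_
  · rw [mul_comm M]
    exact mul_le_mul_of_nonneg_left h2 (norm_nonneg _)
  · rw [show s * (2 * (η / (2 * (s + 1)))) = η * (s / (s + 1)) by field_simp]
    exact mul_le_of_le_one_right hη.le ((div_le_one (by positivity)).2 (by linarith))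

theorem hasSummableIndex_of_alpha_lt_top (hK : IsCompact K) {q : ℝ} (hq : 1 ≤ q)
    (hpq : 1 / p + 1 / ENNReal.ofReal q = 1) (h : alpha ξ p K < ⊤) : HasSummableIndex ξ q K := by
  obtain ⟨α, hα, H⟩ := (alpha_lt_top_iff (one_le_of_conj hpq)).1 h
  refine ⟨5 * α, by positivity, fun l hl hne => ?_⟩
  obtain ⟨n, ε, rfl⟩ : ∃ n, ∃ ε : Fin n → ℝ, l = List.ofFn ε := ⟨_, l.get, (List.ofFn_get l).symm⟩
  rw [List.map_ofFn, List.sum_ofFn]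
  rcases eq_or_ne n 0 with rfl | hn
  · simp only [Finset.univ_eq_empty, Finset.sum_empty]
    positivity
  have hn1 : 1 ≤ n := Nat.one_le_iff_ne_zero.2 hn
  refine sum_rpow_le_of_forall (𝕜 := 𝕜) hq hn (by positivity) hpq
    (fun i => hl _ (List.mem_ofFn.2 ⟨i, rfl⟩)) fun a ha => ?_
  refine le_of_forall_pos_le_add fun η hη => ?_
  set s := ∑ i, a i with hs
  have hs0 : 0 ≤ s := Finset.sum_nonneg fun i _ => ha i
  obtain ⟨x, hx, hnull, hlow⟩ := exists_weaklyNull_of_foldDerivative_nonempty hK hne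
    (δ := η / (5 * (s + 1))) (by positivity)
  have h1 := H n hn1 _ (fun i => (a i : 𝕜)) x hx hnull
  have hmax : maxNodes (dTree (Gamma ξ n) (WeakNhd 𝕜 X)) = dTree (branches ξ n) _ := by
    rw [maxNodes_dTree, maxNodes_Gamma_eq hn1]
  have : Nonempty (maxNodes (dTree (Gamma ξ n) (WeakNhd 𝕜 X))) := by
    rw [hmax]
    exact (nonempty_dTree (nonempty_branches (nonempty_maxNodes_Gamma₁ ξ) n)).to_subtype
  have h2 := (le_ciInf fun t : maxNodes (dTree (Gamma ξ n) (WeakNhd 𝕜 X)) =>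
    hlow a ha t (hmax.subset t.2) hn).trans h1
  have e : ∑ i, a i * (ε i / 5 - η / (5 * (s + 1))) =
      (∑ i, a i * ε i) / 5 - s * (η / (5 * (s + 1))) := by
    simp only [mul_sub, Finset.sum_sub_distrib, ← Finset.sum_mul, ← mul_div_assoc,
      ← Finset.sum_div]
    rw [← hs]
  rw [e] at h2
  have h3 : s * (η / (5 * (s + 1))) ≤ η / 5 := by
    rw [show s * (η / (5 * (s + 1))) = η / 5 * (s / (s + 1)) by field_simp]
    exact mul_le_of_le_one_right (by positivity) ((div_le_one (by positivity)).2 (by linarith))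
  linarith

end Alpha

/-! ### Summability and the power type -/

section PowerType

variable {𝕜 : Type v} [RCLike 𝕜] {X : Type u} [NormedAddCommGroup X] [NormedSpace 𝕜 X]
  {ξ : Ordinal.{w}} {K : Set (WeakDual 𝕜 X)} {ε : ℝ}

theorem foldDerivative_replicate (ε : ℝ) (o : Ordinal.{w}) (S : Set (WeakDual 𝕜 X)) (m : ℕ) :
    foldDerivative o (List.replicate m ε) S = iterDerivative ε (o * (m : ℕ)) S := by
  induction m with
  | zero => simp
  | succ m ih =>
    rw [Nat.cast_add, Nat.cast_one, mul_add, mul_one, iterDerivative_add, ← ih]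
    rfl

theorem szlenkIndexAt_le_iff {o : Ordinal.{w}} :
    szlenkIndexAt K ε ≤ (o : WithTop Ordinal.{w}) ↔ iterDerivative ε o K = ∅ := by
  rw [szlenkIndexAt]
  split_ifs with h
  · rw [WithTop.coe_le_coe]
    constructor
    · intro ho
      have := csInf_mem (s := {o : Ordinal.{w} | iterDerivative ε o K = ∅}) h
      exact subset_empty_iff.1 ((iterDerivative_anti ε K ho).trans_eq this)
    · exact fun ho => csInf_le' ho
  · simp only [top_le_iff, WithTop.coe_ne_top, false_iff]
    exact fun ho => h ⟨o, ho⟩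

theorem szlenkCount_le {m : ℕ} (hm : 1 ≤ m)
    (h : iterDerivative ε (Ordinal.omega0 ^ ξ * m) K = ∅) : szlenkCount ξ K ε ≤ m :=
  Nat.sInf_le ⟨hm, szlenkIndexAt_le_iff.2 h⟩

theorem szlenkCount_spec (h : ∃ m : ℕ, 1 ≤ m ∧ iterDerivative ε (Ordinal.omega0 ^ ξ * m) K = ∅) :
    1 ≤ szlenkCount ξ K ε ∧
      iterDerivative ε (Ordinal.omega0 ^ ξ * (szlenkCount ξ K ε : ℕ)) K = ∅ := by
  obtain ⟨m, hm, h⟩ := h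
  have := Nat.sInf_mem (s := {n : ℕ | 1 ≤ n ∧
    szlenkIndexAt K ε ≤ ((Ordinal.omega0 ^ ξ * n : Ordinal.{w}) : WithTop Ordinal.{w})})
    ⟨m, hm, szlenkIndexAt_le_iff.2 h⟩
  exact ⟨this.1, szlenkIndexAt_le_iff.1 this.2⟩

theorem opow_mul_lt_opow_succ (ξ : Ordinal.{w}) (m : ℕ) :
    Ordinal.omega0 ^ ξ * m < Ordinal.omega0 ^ (ξ + 1) := by
  rw [Ordinal.opow_add, Ordinal.opow_one]
  exact mul_lt_mul_of_pos_left (Ordinal.natCast_lt_omega0 m)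
    (Ordinal.opow_pos _ Ordinal.omega0_pos)

/-- If `Sz(K) ≤ ω ^ (ξ + 1)`, every `Sz(K, ε)` is even below `ω ^ (ξ + 1)`. -/
theorem exists_iterDerivative_eq_empty (hK : IsCompact K) (hε : 0 < ε)
    (h : szlenkIndex K ≤ ((Ordinal.omega0 ^ (ξ + 1) : Ordinal.{w}) : WithTop Ordinal.{w})) :
    ∃ m : ℕ, 1 ≤ m ∧ iterDerivative ε (Ordinal.omega0 ^ ξ * m) K = ∅ := by
  have h1 : szlenkIndexAt K ε ≤ ((Ordinal.omega0 ^ (ξ + 1) : Ordinal.{w}) : WithTop Ordinal.{w}) :=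
    (le_iSup (fun ε : Ioi (0 : ℝ) => szlenkIndexAt K ε) ⟨ε, hε⟩).trans h
  rw [szlenkIndexAt_le_iff] at h1
  by_contra! hc
  refine (iterDerivative_opow_succ_nonempty hK (ε := ε) (ξ := ξ) fun m => ?_).ne_empty h1
  refine (hc (m + 1) (by omega)).mono (iterDerivative_anti _ _ ?_)
  exact mul_le_mul_right (by exact_mod_cast m.le_succ) _

theorem powerType_le_of_hasSummableIndex {q : ℝ} (hq : 1 ≤ q)
    (h : HasSummableIndex ξ q K) : powerType ξ K ≤ ENNReal.ofReal q := by
  obtain ⟨M, hM, h⟩ := h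
  have hq0 : 0 < q := by linarith
  have hMq : 0 ≤ M ^ q := Real.rpow_nonneg hM q
  have key : ∀ ε : ℝ, 0 < ε → ∀ m : ℕ, M ^ q * ε ^ (-q) < m →
      iterDerivative ε (Ordinal.omega0 ^ ξ * m) K = ∅ := by
    intro ε hε m hm
    by_contra hne
    rw [← foldDerivative_replicate, ← ne_eq, ← nonempty_iff_ne_empty] at hne
    have := h _ (fun e he => by rw [List.eq_of_mem_replicate he]; exact hε.le) hne
    rw [List.map_replicate, List.sum_replicate, nsmul_eq_mul] at this
    have h2 : (m : ℝ) ≤ M ^ q * ε ^ (-q) := by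
      rw [Real.rpow_neg hε.le, ← div_eq_mul_inv, le_div_iff₀ (Real.rpow_pos_of_pos hε q)]
      exact this
    exact hm.not_ge h2
  have hm : ∀ ε : ℝ, 0 < ε → 1 ≤ ⌊M ^ q * ε ^ (-q)⌋₊ + 1 ∧
      iterDerivative ε (Ordinal.omega0 ^ ξ * (⌊M ^ q * ε ^ (-q)⌋₊ + 1 : ℕ)) K = ∅ :=
    fun ε hε => ⟨by omega, key ε hε _ (by exact_mod_cast Nat.lt_floor_add_one _)⟩
  have hidx : szlenkIndex K ≤ ((Ordinal.omega0 ^ (ξ + 1) : Ordinal.{w}) : WithTop Ordinal.{w}) := by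
    refine iSup_le fun ε => (szlenkIndexAt_le_iff.2 (hm ε ε.2).2).trans ?_
    exact WithTop.coe_le_coe.2 (opow_mul_lt_opow_succ _ _).le
  rw [powerType, if_pos hidx]
  set c := Real.log (M ^ q + 1) with hc
  have hlog : Tendsto (fun ε : ℝ => |Real.log ε|) (𝓝[>] 0) atTop :=
    tendsto_abs_atBot_atTop.comp Real.tendsto_log_nhdsGT_zero
  have hlim : Tendsto (fun ε : ℝ => ENNReal.ofReal (q + c / |Real.log ε|)) (𝓝[>] 0)
      (𝓝 (ENNReal.ofReal q)) := by
    refine ENNReal.tendsto_ofReal ?_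
    simpa using (hlog.const_div_atTop c).const_add q
  rw [← hlim.limsup_eq]
  refine limsup_le_limsup ?_
  filter_upwards [self_mem_nhdsWithin, Ioo_mem_nhdsGT one_pos] with ε hε hε1
  refine ENNReal.ofReal_le_ofReal ?_
  have hlogε : Real.log ε < 0 := Real.log_neg hε1.1 hε1.2
  have hpos : 0 < |Real.log ε| := abs_pos.2 hlogε.ne
  have hcount := szlenkCount_le (hm ε hε).1 (hm ε hε).2
  have hcount1 := (szlenkCount_spec ⟨_, hm ε hε⟩).1
  have hpow : 1 ≤ ε ^ (-q) := Real.one_le_rpow_of_pos_of_le_one_of_nonpos hε1.1 hε1.2.le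
    (by linarith)
  have h1 : (szlenkCount ξ K ε : ℝ) ≤ (M ^ q + 1) * ε ^ (-q) := by
    calc (szlenkCount ξ K ε : ℝ) ≤ (⌊M ^ q * ε ^ (-q)⌋₊ : ℝ) + 1 := by exact_mod_cast hcount
      _ ≤ M ^ q * ε ^ (-q) + ε ^ (-q) :=
        add_le_add (Nat.floor_le (mul_nonneg hMq (by linarith))) hpow
      _ = _ := by ring
  have h2 : Real.log (szlenkCount ξ K ε) ≤ c + q * |Real.log ε| := by
    refine (Real.log_le_log (by exact_mod_cast hcount1) h1).trans_eq ?_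
    rw [Real.log_mul (by positivity) (by positivity), Real.log_rpow hε1.1, abs_of_neg hlogε]
    ring
  rw [div_le_iff₀ hpos, add_mul, div_mul_cancel₀ _ hpos.ne']
  linarith

theorem countP_ofFn {n : ℕ} (f : Fin n → ℝ) (η : ℝ) :
    (List.ofFn f).countP (fun ε => decide (η ≤ ε)) =
      (Finset.univ.filter fun i => η ≤ f i).card := by
  induction n with
  | zero => simp
  | succ n ih =>
    rw [List.ofFn_succ, List.countP_cons, ih, Finset.card_filter, Finset.card_filter,
      Fin.sum_univ_succ, add_comm]
    simp

/-- If at most `C η ^ (-s)` of the numbers `f i` exceed `η`, for every `η > 0`, then the `k`-th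
largest of them is at most `(C / k) ^ (1 / s)`. -/
theorem sum_rpow_le_sum_range {ι : Type*} {f : ι → ℝ} (hf : ∀ i, 0 ≤ f i) {C s r : ℝ} (hs : 0 < s)
    (hr : 0 < r) (A : Finset ι)
    (h : ∀ η : ℝ, 0 < η → ((A.filter fun i => η ≤ f i).card : ℝ) ≤ C * η ^ (-s)) :
    ∑ i ∈ A, f i ^ r ≤ ∑ j ∈ Finset.range A.card, (C / ((j : ℝ) + 1)) ^ (r / s) := by
  classical
  induction A using Finset.induction_on_min_value f with
  | empty => simp
  | insert a A ha hmin ih =>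
    rw [Finset.sum_insert ha, Finset.card_insert_of_notMem ha, Finset.sum_range_succ, add_comm]
    refine add_le_add (ih fun η hη => ?_) ?_
    · refine le_trans ?_ (h η hη)
      exact_mod_cast Finset.card_le_card (Finset.filter_subset_filter _ (Finset.subset_insert _ _))
    · have hC : 0 ≤ C := by
        have := h 1 one_pos
        rw [Real.one_rpow, mul_one] at this
        exact (Nat.cast_nonneg _).trans this
      rcases (hf a).eq_or_lt with h0 | h0
      · rw [← h0, Real.zero_rpow hr.ne']
        positivity
      · have h1 := h (f a) h0
        rw [Finset.filter_true_of_mem (by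
          intro i hi
          rcases Finset.mem_insert.1 hi with rfl | hi
          · rfl
          · exact hmin i hi), Finset.card_insert_of_notMem ha, Real.rpow_neg h0.le,
          ← div_eq_mul_inv, le_div_iff₀ (Real.rpow_pos_of_pos h0 s)] at h1
        push_cast at h1
        have h2 : f a ^ s ≤ C / ((A.card : ℝ) + 1) := by
          rw [le_div_iff₀ (by positivity), mul_comm]
          exact h1
        calc f a ^ r = (f a ^ s) ^ (r / s) := by
              rw [← Real.rpow_mul h0.le, mul_div_cancel₀ _ hs.ne']
          _ ≤ _ := Real.rpow_le_rpow (Real.rpow_nonneg h0.le s) h2 (by positivity)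

theorem exists_sum_range_le {C t : ℝ} (hC : 0 ≤ C) (ht : 1 < t) :
    ∃ T : ℝ, 0 ≤ T ∧ ∀ n : ℕ, ∑ j ∈ Finset.range n, (C / ((j : ℝ) + 1)) ^ t ≤ T := by
  have h1 : Summable fun j : ℕ => (C / ((j : ℝ) + 1)) ^ t := by
    have := ((summable_nat_add_iff 1).2 (Real.summable_one_div_nat_rpow.2 ht)).mul_left (C ^ t)
    refine this.congr fun j => ?_
    push_cast
    rw [Real.div_rpow hC (by positivity), mul_one_div]
  have h0 : ∀ j : ℕ, 0 ≤ (C / ((j : ℝ) + 1)) ^ t := fun j => by positivity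
  exact ⟨_, tsum_nonneg h0, fun n => h1.sum_le_tsum _ fun j _ => h0 j⟩

/-- If `𝐩_ξ(K) < s < r`, the number of `ε_i ≥ η` in a non-empty derivation is at most a multiple
of `η ^ (-s)`, which makes `∑ ε_i ^ r` bounded. -/
theorem hasSummableIndex_of_powerType_lt [CompleteSpace X] (hK : IsCompact K) {s r : ℝ}
    (hs : 0 < s) (hsr : s < r) (h : powerType ξ K < ENNReal.ofReal s) : HasSummableIndex ξ r K := by
  have hidx : szlenkIndex K ≤ ((Ordinal.omega0 ^ (ξ + 1) : Ordinal.{w}) : WithTop Ordinal.{w}) := by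
    by_contra hc
    rw [powerType, if_neg hc] at h
    exact not_top_lt h
  rw [powerType, if_pos hidx] at h
  have hev := eventually_lt_of_limsup_lt h
  obtain ⟨b, hb, hsub⟩ := mem_nhdsGT_iff_exists_Ioo_subset.1 (hev.and (Ioo_mem_nhdsGT one_pos))
  have hb : 0 < b := hb
  have hcount : ∀ η ∈ Ioo 0 b, (szlenkCount ξ K η : ℝ) ≤ η ^ (-s) := by
    intro η hη
    obtain ⟨h1, h2⟩ := hsub hη
    have hlogη : Real.log η < 0 := Real.log_neg h2.1 h2.2
    have hpos : 0 < |Real.log η| := abs_pos.2 hlogη.ne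
    have h1 := (ENNReal.ofReal_lt_ofReal_iff hs).1 h1
    rw [div_lt_iff₀ hpos, abs_of_neg hlogη] at h1
    have h3 := (szlenkCount_spec (exists_iterDerivative_eq_empty hK hη.1 hidx)).1
    rw [← Real.log_le_log_iff (by exact_mod_cast h3) (Real.rpow_pos_of_pos hη.1 _),
      Real.log_rpow hη.1]
    linarith
  obtain ⟨R, hR0, hR⟩ := exists_norm_bound hK
  set C : ℝ := 1 + (b / 2) ^ (-s) * (4 * R) ^ s with hC
  have hb' : 0 ≤ (b / 2) ^ (-s) * (4 * R) ^ s := by positivity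
  have hbound : ∀ η : ℝ, 0 < η → ∀ j : ℕ,
      (iterDerivative η (Ordinal.omega0 ^ ξ * j) K).Nonempty → (j : ℝ) ≤ C * η ^ (-s) := by
    intro η hη j hne
    have hη0 : 0 < η ^ (-s) := Real.rpow_pos_of_pos hη _
    have hlt : ∀ η' ∈ Ioo 0 b, η' ≤ η → (j : ℝ) ≤ η' ^ (-s) := by
      intro η' hη' hle
      refine le_trans ?_ (hcount η' hη')
      by_contra! hlt
      have hlt : szlenkCount ξ K η' < j := by exact_mod_cast hlt
      have h1 := hne.mono (iterDerivative_mono Subset.rfl hle _)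
      refine (h1.mono (iterDerivative_anti _ _ ?_)).ne_empty
        (szlenkCount_spec (exists_iterDerivative_eq_empty hK hη'.1 hidx)).2
      exact mul_le_mul_right (by exact_mod_cast hlt.le) _
    rcases le_or_gt η (b / 2) with h1 | h1
    · refine (hlt η ⟨hη, by linarith⟩ le_rfl).trans ?_
      exact le_mul_of_one_le_left hη0.le (by linarith)
    rcases Nat.eq_zero_or_pos j with rfl | hj
    · simp only [Nat.cast_zero]
      positivity
    -- the derivation is empty once `η` exceeds the norms of all differences
    have hηR : η ≤ 4 * R := by
      obtain ⟨g, hg⟩ := hne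
      have h1 : (1 : Ordinal.{w}) ≤ Ordinal.omega0 ^ ξ * j := by
        rw [Order.one_le_iff_pos]
        exact mul_pos (Ordinal.opow_pos _ Ordinal.omega0_pos) (by exact_mod_cast hj)
      have hg := iterDerivative_anti _ _ h1 hg
      rw [← zero_add (1 : Ordinal.{w}), iterDerivative_add_one hη, iterDerivative_zero] at hg
      obtain ⟨y, hy, hlt⟩ := exists_norm_sub_gt hg univ_mem
      have hb : ∀ f ∈ K, ‖WeakDual.toStrongDual f‖ ≤ R := fun f hf =>
        ContinuousLinearMap.opNorm_le_bound _ hR0 (hR f hf)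
      have := norm_sub_le (WeakDual.toStrongDual y) (WeakDual.toStrongDual g)
      linarith [hb y hy.2, hb g hg.1]
    refine (hlt (b / 2) ⟨by positivity, by linarith⟩ h1.le).trans ?_
    have h2 : 1 ≤ (4 * R) ^ s * η ^ (-s) := by
      rw [Real.rpow_neg hη.le, ← div_eq_mul_inv, one_le_div (Real.rpow_pos_of_pos hη s)]
      exact Real.rpow_le_rpow hη.le hηR hs.le
    calc (b / 2) ^ (-s) ≤ (b / 2) ^ (-s) * ((4 * R) ^ s * η ^ (-s)) :=
          le_mul_of_one_le_right (by positivity) h2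
      _ = ((b / 2) ^ (-s) * (4 * R) ^ s) * η ^ (-s) := by ring
      _ ≤ C * η ^ (-s) := by
        refine mul_le_mul_of_nonneg_right ?_ hη0.le
        linarith
  have hr : 0 < r := hs.trans hsr
  obtain ⟨T, hT, hsum⟩ := exists_sum_range_le (C := C) (by positivity) ((one_lt_div hs).2 hsr)
  refine ⟨T ^ (1 / r), by positivity, fun l hl hne => ?_⟩
  rw [← Real.rpow_mul hT, one_div, inv_mul_cancel₀ hr.ne', Real.rpow_one]
  obtain ⟨n, f, rfl⟩ : ∃ n, ∃ f : Fin n → ℝ, l = List.ofFn f := ⟨_, l.get, (List.ofFn_get l).symm⟩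
  rw [List.map_ofFn, List.sum_ofFn]
  refine (sum_rpow_le_sum_range (fun i => hl _ (List.mem_ofFn.2 ⟨i, rfl⟩)) hs hr Finset.univ
    fun η hη => ?_).trans (hsum _)
  rw [← countP_ofFn]
  exact hbound η hη _ (hne.mono (foldDerivative_subset_count _ _ _ η))

end PowerType

end Szlenk

theorem mainTheorem2 {𝕜 : Type v} [RCLike 𝕜] {X : Type u} [NormedAddCommGroup X]
    [NormedSpace 𝕜 X] [CompleteSpace X] (ξ : Ordinal.{w}) (K : Set (WeakDual 𝕜 X))
    (hK : IsCompact K) :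
    (∀ p q : ℝ≥0∞, q = max (Szlenk.powerType ξ K) 1 → 1 / p + 1 / q = 1 →
      p = sSup {r : ℝ≥0∞ | 1 ≤ r ∧ Szlenk.alpha ξ r K < ⊤}) ∧
    (∀ (q : ℝ) (p : ℝ≥0∞), 1 ≤ q → 1 / p + 1 / ENNReal.ofReal q = 1 →
      (Szlenk.HasSummableIndex ξ q K ↔ Szlenk.alpha ξ p K < ⊤)) := by
  have hii : ∀ (q : ℝ) (p : ℝ≥0∞), 1 ≤ q → 1 / p + 1 / ENNReal.ofReal q = 1 →
      (Szlenk.HasSummableIndex ξ q K ↔ Szlenk.alpha ξ p K < ⊤) := fun q p hq hpq =>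
    ⟨Szlenk.alpha_lt_top_of_hasSummableIndex hK hq hpq,
      Szlenk.hasSummableIndex_of_alpha_lt_top hK hq hpq⟩
  refine ⟨fun p q hq hpq => le_antisymm ?_ ?_, hii⟩
  · refine le_of_forall_lt_imp_le_of_dense fun r hr => ?_
    rcases le_or_gt r 1 with h1 | h1
    · exact h1.trans (le_sSup ⟨le_rfl, Szlenk.alpha_one_lt_top hK⟩)
    · obtain ⟨r', hr', hconj⟩ := Szlenk.exists_conj h1
      have hlt : q < ENNReal.ofReal r' := (Szlenk.conj_lt_iff hconj hpq).1 hr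
      obtain ⟨s, hs, hqs, hsr⟩ := ENNReal.lt_iff_exists_real_btwn.1 hlt
      have hs0 : 0 < s := by
        by_contra! h0
        rw [ENNReal.ofReal_of_nonpos h0] at hqs
        exact not_lt_zero hqs
      refine le_sSup ⟨h1.le, (hii r' r hr' hconj).1 ?_⟩
      refine Szlenk.hasSummableIndex_of_powerType_lt hK hs0
        ((ENNReal.ofReal_lt_ofReal_iff (by linarith)).1 hsr) (lt_of_le_of_lt ?_ hqs)
      rw [hq]
      exact le_max_left _ _
  · refine sSup_le ?_
    rintro r ⟨-, hα⟩
    by_contra! hpr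
    obtain ⟨r', hr', hconj⟩ := Szlenk.exists_conj ((Szlenk.one_le_of_conj hpq).trans_lt hpr)
    have hlt : ENNReal.ofReal r' < q := (Szlenk.conj_lt_iff hpq hconj).1 hpr
    have h1 := Szlenk.powerType_le_of_hasSummableIndex hr' ((hii r' r hr' hconj).2 hα)
    have h2 : (1 : ℝ≥0∞) ≤ ENNReal.ofReal r' := by
      rwa [← ENNReal.ofReal_one, ENNReal.ofReal_le_ofReal_iff (by linarith)]
    rw [hq] at hlt
    exact (max_le h1 h2).not_gt hlt
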